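/- Let $\Omega\subset\mathbb{C}$ be a bounded, simply connected domain with piecewise smooth boundary: there is a closed curve $\gamma:\mathbb{R}\to\mathbb{C}$, continuous and of period $1$, with image $\partial\Omega$, which consists over one period of finitely many regular $C^1$ arcs that meet only at their endpoints, and which traverses $\partial\Omega$ counterclockwise, i.e. with $\Omega$ always on its left (for every $t$ that is not an endpoint parameter of an arc, $\gamma(t)+i\varepsilon\gamma'(t)\in\Omega$ for all small $\varepsilon>0$). Let $\varphi$ be a zero mode of the two-dimensional elastic problem with bulk modulus $B=0$ on $\Omega$, that is, a bounded analytic function on $\Omega$, and suppose that $\varphi$ extends analytically to an open set containing $\Omega\cup\partial\Omega$. Suppose that $\varphi$ is edge-localized in the sense that there is $z_1\in\Omega$ with $0<|\varphi(z_1)|<|\varphi(z)|$ for all $z\in\partial\Omega$. Then: 1. $\varphi$ has a zero in $\Omega$ and no zeros on $\partial\Omega$. 2. The zeros of $\varphi$ in $\Omega$ are finite in number, and if $N_0$ denotes their number counted with multiplicity, then $$\frac{1}{2\pi i}\oint_{\partial\Omega}\frac{\varphi'(z)}{\varphi(z)}\,dz=N_0\ge 1 .$$ 3. The phase of $\varphi$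 turns counterclockwise $N_0$ times along the boundary: there is a continuous $\theta:\mathbb{R}\to\mathbb{R}$ with $\varphi(\gamma(s))=|\varphi(\gamma(s))|e^{i\theta(s)}$ for all $s$, and every such $\theta$ satisfies $\theta(s+1)-\theta(s)=2\pi N_0$ for all $s$. 4. (Spin-momentum locking.) Let $\omega>0$. On the boundary, the points of constant phase of the spin-up wave $\varphi(z)e^{i\omega t}$ move clockwise, and those of the spin-down wave $\varphi(z)e^{-i\omega t}$ move counterclockwise, on average, at $\omega/(2\pi N_0)$ turns around $\partial\Omega$ per unit of time. Precisely, for each sign there is a continuous $\Theta:\mathbb{R}\times\mathbb{R}\to\mathbb{R}$ with $\varphi(\gamma(s))e^{\pm i\omega t}=|\varphi(\gamma(s))|e^{i\Theta(s,t)}$ for all $s,t$; and for every such $\Theta$ and every $c\in\mathbb{R}$, there is for each time $t$ an $s$ with $\Theta(s,t)=c$, and every choice of $s(t)$ with $\Theta(s(t),t)=c$ for all $t$ satisfies $s(t)/t\to\mp\,\omega/(2\pi N_0)$ as $t\to\infty$. -/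

import Mathlib

open Set Filter Topology

/-- `γ` is a counterclockwise parametrization, of period one, of the piecewise smooth boundary of
the plane domain `Ω`. The boundary consists of finitely many regular `C¹` arcs that meet only at
their endpoints (the points with parameter in the finite set `S`); `γ` is a closed curve that
traverses them once, with `Ω` always on the left-hand side. -/
structure IsPositiveBoundary (Ω : Set ℂ) (γ : ℝ → ℂ) : Prop where
  continuous : Continuous γ
  periodic : Function.Periodic γ 1
  image_eq : γ '' Icc 0 1 = frontier Ω
  piecewise_smooth : ∃ S : Set ℝ, S.Finite ∧ 0 ∈ S ∧ 1 ∈ S ∧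
    -- every piece between break points is a regular `C¹` arc, up to its endpoints
    (∀ a b : ℝ, 0 ≤ a → a < b → b ≤ 1 → Disjoint (Ioo a b) S →
      ContDiffOn ℝ 1 γ (Icc a b) ∧ ∀ t ∈ Icc a b, derivWithin γ (Icc a b) t ≠ 0) ∧
    -- the arcs are simple and meet only at their endpoints
    (∀ t ∈ Icc (0 : ℝ) 1 \ S, ∀ s ∈ Icc (0 : ℝ) 1, γ s = γ t → s = t) ∧
    -- `Ω` lies on the left: the left normal `i γ'(t)` points into `Ω`
    (∀ t ∈ Icc (0 : ℝ) 1 \ S, ∀ᶠ ε : ℝ in 𝓝[>] 0,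
      γ t + (ε : ℂ) * (Complex.I * deriv γ t) ∈ Ω)

/-- The contour integral `∮ f(z) dz` over one period of the closed curve `γ`. -/
noncomputable def contourIntegral (f : ℂ → ℂ) (γ : ℝ → ℂ) : ℂ :=
  ∫ t in (0 : ℝ)..1, f (γ t) * deriv γ t

/-- The number of zeros of `φ` in `Ω`, counted with multiplicity. -/
noncomputable def zeroCount (φ : ℂ → ℂ) (Ω : Set ℂ) : ℕ :=
  ∑ᶠ z ∈ Ω, analyticOrderNatAt φ z

/-- `θ` is a continuous choice of phase for `f`: `f = |f| e^{iθ}`. -/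
def IsPhase {X : Type*} [TopologicalSpace X] (f : X → ℂ) (θ : X → ℝ) : Prop :=
  Continuous θ ∧ ∀ x, f x = (‖f x‖ : ℂ) * Complex.exp ((θ x : ℂ) * Complex.I)

/-- The wave `ψ(z, t) = φ(z) e^{iωt}`; it is spin-up for `ω > 0` and spin-down for `ω < 0`. -/
noncomputable def spinWave (φ : ℂ → ℂ) (ω : ℝ) (z : ℂ) (t : ℝ) : ℂ :=
  φ z * Complex.exp (Complex.I * (ω : ℂ) * (t : ℂ))

/-- The points of constant phase of the wave `ψ` on the closed curve `γ` travel along `γ` with mean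
velocity `v`, in turns around `γ` per unit of time and positive in the direction of `γ`.
Here the phase `Θ` depends continuously on the position `s` along `γ` (which counts turns) and the
time `t`; for every phase value `c` there is at all times a point with phase `c`, and however such
points `s t` are chosen, `s t / t` tends to `v`. -/
def PhasePointsTravel (ψ : ℂ → ℝ → ℂ) (γ : ℝ → ℂ) (v : ℝ) : Prop :=
  (∃ Θ : ℝ × ℝ → ℝ, IsPhase (fun p : ℝ × ℝ => ψ (γ p.1) p.2) Θ) ∧
  ∀ Θ : ℝ × ℝ → ℝ, IsPhase (fun p : ℝ × ℝ => ψ (γ p.1) p.2) Θ → ∀ c : ℝ,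
    (∀ t : ℝ, ∃ s : ℝ, Θ (s, t) = c) ∧
    ∀ s : ℝ → ℝ, (∀ t, Θ (s t, t) = c) → Tendsto (fun t => s t / t) atTop (𝓝 v)

/-! The value at `z₁` is nonzero and smaller in modulus than all boundary values, so φ has no
boundary zeros, and the maximum principle for 1/φ forces a zero inside. The rest comes from
evaluating the integral of φ'/φ along γ in two ways: it is 2πi times the number of zeros, and i
times the increment of the phase over a period.

The topological core is that γ winds once around points of Ω and not at all around exterior points.
This follows from the left-hand condition, without the Jordan curve theorem. The winding number
jumps by one across a regular simple point (`tendsto_windingIntegral_sub`). Nearest points carry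
this jump to exterior points, and connectedness of the plane minus a finite set disposes of those
whose nearest point is a corner (`windingIntegral_eq_of_notMem_closure`). Decay at infinity fixes
the values. Cauchy's theorem in homology form, by Dixon's argument (`cauchyTransform_eq`), then
applies, and zeros are split off one at a time (`argument_principle`).

The wave with factor exp(iωt) has phase θ(s) + ωt up to a constant, and θ(s) - 2πN₀s is periodic,
hence bounded. A fixed phase therefore forces s = -ωt/(2πN₀) + O(1) (`phasePointsTravel_spinWave`).
-/

/-! ### Calculus along rectifiable loops -/

/-- A closed curve, parametrized by `[0, 1]`, which is differentiable off a countable set and has an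
integrable derivative. -/
structure IsRectifiableLoop (γ : ℝ → ℂ) : Prop where
  continuous : Continuous γ
  closed : γ 0 = γ 1
  exists_hasDerivAt : ∃ T : Set ℝ, T.Countable ∧ ∀ t ∈ Ioo (0 : ℝ) 1 \ T, DifferentiableAt ℝ γ t
  integrable : IntervalIntegrable (deriv γ) MeasureTheory.volume 0 1

namespace IsRectifiableLoop

variable {γ : ℝ → ℂ} (hγ : IsRectifiableLoop γ)

include hγ

lemma integrable_mul {g : ℝ → ℂ} (hg : ContinuousOn g (Icc 0 1)) :
    IntervalIntegrable (fun t => g t * deriv γ t) MeasureTheory.volume 0 1 :=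
  hγ.integrable.continuousOn_mul (by rwa [uIcc_of_le zero_le_one])

lemma integrable_comp_mul {f : ℂ → ℂ} (hf : ContinuousOn f (γ '' Icc 0 1)) :
    IntervalIntegrable (fun t => f (γ t) * deriv γ t) MeasureTheory.volume 0 1 :=
  hγ.integrable_mul (hf.comp hγ.continuous.continuousOn (mapsTo_image _ _))

/-- The fundamental theorem of calculus along a part of the curve. -/
lemma integral_eq_sub {f F : ℂ → ℂ} {a b : ℝ} (ha : 0 ≤ a) (hab : a ≤ b) (hb : b ≤ 1)
    (hf : ContinuousOn f (γ '' Icc a b)) (hF : ∀ t ∈ Icc a b, HasDerivAt F (f (γ t)) (γ t)) :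
    ∫ t in a..b, f (γ t) * deriv γ t = F (γ b) - F (γ a) := by
  obtain ⟨T, hT, hd⟩ := hγ.exists_hasDerivAt
  refine MeasureTheory.integral_eq_of_hasDerivAt_off_countable_of_le (fun t => F (γ t)) _ hab hT
    ?_ ?_ ?_
  · intro t ht
    exact ((hF t ht).continuousAt.comp hγ.continuous.continuousAt).continuousWithinAt
  · intro t ht
    exact (hF t (Ioo_subset_Icc_self ht.1)).comp t
      (hd t ⟨⟨ha.trans_lt ht.1.1, ht.1.2.trans_le hb⟩, ht.2⟩).hasDerivAt
  · refine (hγ.integrable.mono_set ?_).continuousOn_mul ?_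
    · rw [uIcc_of_le hab, uIcc_of_le zero_le_one]
      exact Icc_subset_Icc ha hb
    · rw [uIcc_of_le hab]
      exact hf.comp hγ.continuous.continuousOn (mapsTo_image _ _)

lemma contourIntegral_eq_zero_of_hasDerivAt {f F : ℂ → ℂ} (hf : ContinuousOn f (γ '' Icc 0 1))
    (hF : ∀ z ∈ γ '' Icc 0 1, HasDerivAt F (f z) z) : contourIntegral f γ = 0 := by
  rw [contourIntegral, hγ.integral_eq_sub le_rfl zero_le_one le_rfl hf
    fun t ht => hF _ (mem_image_of_mem _ ht), hγ.closed, sub_self]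

lemma contourIntegral_add {f g : ℂ → ℂ} (hf : ContinuousOn f (γ '' Icc 0 1))
    (hg : ContinuousOn g (γ '' Icc 0 1)) :
    contourIntegral (fun z => f z + g z) γ = contourIntegral f γ + contourIntegral g γ := by
  simp only [contourIntegral, add_mul]
  exact intervalIntegral.integral_add (hγ.integrable_comp_mul hf) (hγ.integrable_comp_mul hg)

lemma contourIntegral_sub {f g : ℂ → ℂ} (hf : ContinuousOn f (γ '' Icc 0 1))
    (hg : ContinuousOn g (γ '' Icc 0 1)) :
    contourIntegral (fun z => f z - g z) γ = contourIntegral f γ - contourIntegral g γ := by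
  simp only [contourIntegral, sub_mul]
  exact intervalIntegral.integral_sub (hγ.integrable_comp_mul hf) (hγ.integrable_comp_mul hg)

lemma isCompact_image : IsCompact (γ '' Icc 0 1) := isCompact_Icc.image hγ.continuous

end IsRectifiableLoop

lemma contourIntegral_congr {f g : ℂ → ℂ} {γ : ℝ → ℂ} (h : EqOn f g (γ '' Icc 0 1)) :
    contourIntegral f γ = contourIntegral g γ := by
  refine intervalIntegral.integral_congr fun t ht => ?_
  rw [uIcc_of_le zero_le_one] at ht
  simp only [h (mem_image_of_mem γ ht)]

lemma contourIntegral_mul_const (f : ℂ → ℂ) (γ : ℝ → ℂ) (c : ℂ) :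
    contourIntegral (fun z => f z * c) γ = contourIntegral f γ * c := by
  rw [contourIntegral, contourIntegral, ← intervalIntegral.integral_mul_const]
  congr 1
  ext t
  ring

/-! ### Winding integrals and their local constancy -/

/-- The integral `∮ dz / (z - w)`, that is, `2πi` times the winding number of `γ` around `w`. -/
noncomputable def windingIntegral (γ : ℝ → ℂ) (w : ℂ) : ℂ :=
  contourIntegral (fun z => (z - w)⁻¹) γ

lemma continuousOn_sub_inv {K : Set ℂ} {w : ℂ} (hw : w ∉ K) :
    ContinuousOn (fun z => (z - w)⁻¹) K :=
  (continuousOn_id.sub continuousOn_const).inv₀ fun _ hz =>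
    sub_ne_zero.2 (ne_of_mem_of_not_mem hz hw)

namespace IsRectifiableLoop

variable {γ : ℝ → ℂ} (hγ : IsRectifiableLoop γ)

include hγ

/-- The difference of the two kernels has the primitive log((z - w') / (z - w)). It is single-valued
on the curve because the quotient stays within distance 1 of 1 there. -/
lemma windingIntegral_eventuallyEq {w : ℂ} (hw : w ∉ γ '' Icc 0 1) :
    ∀ᶠ w' in 𝓝 w, windingIntegral γ w' = windingIntegral γ w := by
  obtain ⟨r, hr, hball⟩ := Metric.isOpen_iff.1 hγ.isCompact_image.isClosed.isOpen_compl w hw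
  filter_upwards [Metric.ball_mem_nhds w (half_pos hr)] with w' hw'
  have hw'K : w' ∉ γ '' Icc 0 1 := hball (Metric.ball_subset_ball (half_le_self hr.le) hw')
  rw [← sub_eq_zero, windingIntegral, windingIntegral, ← hγ.contourIntegral_sub
    (continuousOn_sub_inv hw'K) (continuousOn_sub_inv hw)]
  refine hγ.contourIntegral_eq_zero_of_hasDerivAt
    (F := fun z => Complex.log ((z - w') / (z - w)))
    ((continuousOn_sub_inv hw'K).sub (continuousOn_sub_inv hw)) fun z hz => ?_
  have h1 : z - w ≠ 0 := sub_ne_zero.2 (ne_of_mem_of_not_mem hz hw)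
  have h2 : z - w' ≠ 0 := sub_ne_zero.2 (ne_of_mem_of_not_mem hz hw'K)
  have hd : HasDerivAt (fun z => (z - w') / (z - w))
      ((1 * (z - w) - (z - w') * 1) / (z - w) ^ 2) z :=
    ((hasDerivAt_id z).sub_const w').div ((hasDerivAt_id z).sub_const w) h1
  have hs : (z - w') / (z - w) ∈ Complex.slitPlane := by
    have hzr : r ≤ ‖z - w‖ := by
      by_contra! h
      exact hball (by simpa [dist_eq_norm] using h) hz
    have : (z - w') / (z - w) = 1 + (w - w') / (z - w) := by
      field_simp
      ring
    rw [this]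
    apply Complex.mem_slitPlane_of_norm_lt_one
    rw [norm_div, div_lt_one (norm_pos_iff.2 h1)]
    have : ‖w - w'‖ < r / 2 := by simpa [dist_eq_norm, norm_sub_rev] using hw'
    linarith
  convert hd.clog hs using 1
  field_simp

lemma windingIntegral_eq_of_isPreconnected {A : Set ℂ} (hA : IsPreconnected A)
    (hd : Disjoint A (γ '' Icc 0 1)) {w w' : ℂ} (hw : w ∈ A) (hw' : w' ∈ A) :
    windingIntegral γ w = windingIntegral γ w' := by
  have : PreconnectedSpace A := Subtype.preconnectedSpace hA
  have hloc : IsLocallyConstant fun z : A => windingIntegral γ z :=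
    (IsLocallyConstant.iff_eventually_eq _).2 fun z => continuousAt_subtype_val.eventually
      (hγ.windingIntegral_eventuallyEq (disjoint_left.1 hd z.2))
  exact hloc.apply_eq_of_preconnectedSpace ⟨w, hw⟩ ⟨w', hw'⟩

end IsRectifiableLoop

/-! ### Holomorphic parameter integrals and Cauchy's theorem -/

/-- An integral of functions that depend holomorphically on a parameter is holomorphic. -/
lemma differentiableAt_integral_of_dominated {α : Type*} [MeasurableSpace α]
    {μ : MeasureTheory.Measure α} {G : ℂ → α → ℂ} {bound : α → ℝ} {z₀ : ℂ} {R : ℝ} (hR : 0 < R)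
    (hmeas : ∀ z ∈ Metric.ball z₀ R, MeasureTheory.AEStronglyMeasurable (G z) μ)
    (hdiff : ∀ᵐ t ∂μ, DifferentiableOn ℂ (fun z => G z t) (Metric.ball z₀ R))
    (hbound : ∀ᵐ t ∂μ, ∀ z ∈ Metric.ball z₀ R, ‖G z t‖ ≤ bound t)
    (hint : MeasureTheory.Integrable bound μ) :
    DifferentiableAt ℂ (fun z => ∫ t, G z t ∂μ) z₀ := by
  have hz₀ : z₀ ∈ Metric.ball z₀ R := Metric.mem_ball_self hR
  have hR2 : 0 < R / 2 := half_pos hR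
  -- Circles of radius R/4 about points of the ball of radius R/2 stay in the given ball, so
  -- Cauchy's estimate bounds the derivative by `bound t / (R / 4)`.
  refine (hasDerivAt_integral_of_dominated_loc_of_deriv_le (F := G)
    (F' := fun z t => deriv (fun z => G z t) z) (bound := fun t => bound t / (R / 4))
    (Metric.ball_mem_nhds z₀ hR2) ?_ ?_ ?_ ?_ ?_ ?_).2.differentiableAt
  · filter_upwards [Metric.ball_mem_nhds z₀ hR] with z hz using hmeas z hz
  · refine hint.mono' (hmeas z₀ hz₀) ?_
    filter_upwards [hbound] with t ht using ht z₀ hz₀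
  -- The derivative at `z₀` is measurable in `t` as a limit of difference quotients along a
  -- sequence.
  · have hu : Tendsto (fun n : ℕ => z₀ + ((R / 2 * (1 / ((n : ℝ) + 1)) : ℝ) : ℂ)) atTop
        (𝓝[≠] z₀) := by
      refine tendsto_nhdsWithin_iff.2 ⟨?_, ?_⟩
      · have h := (tendsto_one_div_add_atTop_nhds_zero_nat (𝕜 := ℝ)).const_mul (R / 2)
        have h' := ((Complex.continuous_ofReal.tendsto _).comp h).const_add z₀
        simpa using h'
      · refine Eventually.of_forall fun n => ?_
        have : R / 2 * (1 / ((n : ℝ) + 1)) ≠ 0 := by positivity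
        rw [mem_compl_singleton_iff, Ne, add_eq_left]
        exact_mod_cast this
    refine aestronglyMeasurable_of_tendsto_ae (u := atTop) (f := fun n : ℕ => fun t =>
      slope (fun z => G z t) z₀ (z₀ + ((R / 2 * (1 / ((n : ℝ) + 1)) : ℝ) : ℂ))) ?_ ?_
    · intro n
      simp only [slope, vsub_eq_sub]
      refine MeasureTheory.AEStronglyMeasurable.const_smul
        (MeasureTheory.AEStronglyMeasurable.sub (f := G _) (hmeas _ ?_) (hmeas _ hz₀))
        (_ : ℂ)
      rw [Metric.mem_ball, dist_eq_norm, add_sub_cancel_left, Complex.norm_real, Real.norm_eq_abs,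
        abs_of_pos (by positivity)]
      have : 1 / ((n : ℝ) + 1) ≤ 1 := by
        rw [div_le_one (by positivity)]
        linarith [n.cast_nonneg (α := ℝ)]
      nlinarith
    · filter_upwards [hdiff] with t ht
      exact (hasDerivAt_iff_tendsto_slope.1
        (ht.differentiableAt (Metric.ball_mem_nhds z₀ hR)).hasDerivAt).comp hu
  · filter_upwards [hdiff, hbound] with t ht hb z hz
    have hsub : Metric.closedBall z (R / 4) ⊆ Metric.ball z₀ R := by
      intro y hy
      rw [Metric.mem_closedBall] at hy
      rw [Metric.mem_ball] at hz ⊢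
      linarith [dist_triangle y z z₀]
    refine Complex.norm_deriv_le_of_forall_mem_sphere_norm_le (by positivity) ?_ ?_
    · exact (ht.mono hsub).diffContOnCl_ball Subset.rfl
    · exact fun y hy => hb y (hsub (Metric.sphere_subset_closedBall hy))
  · exact hint.div_const _
  · filter_upwards [hdiff] with t ht z hz
    exact (ht.differentiableAt (Metric.isOpen_ball.mem_nhds
      (Metric.ball_subset_ball (half_le_self hR.le) hz))).hasDerivAt

/-- For `w` near `z₀` the mean value inequality bounds the slope by the maximum of |f'|. For the
other `w` the denominator is at least r/2. This is the domination needed to differentiate Dixon's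
function. -/
lemma exists_ball_norm_dslope_le {f : ℂ → ℂ} {U K : Set ℂ} (hU : IsOpen U)
    (hf : DifferentiableOn ℂ f U) (hK : IsCompact K) (hKU : K ⊆ U) {z₀ : ℂ} (hz₀ : z₀ ∈ U) :
    ∃ R > 0, Metric.ball z₀ R ⊆ U ∧ ∃ C, ∀ z ∈ Metric.ball z₀ R, ∀ w ∈ K, ‖dslope f w z‖ ≤ C := by
  obtain ⟨r, hr, hrU⟩ := Metric.nhds_basis_closedBall.mem_iff.1 (hU.mem_nhds hz₀)
  obtain ⟨M, hM⟩ := (hK.union (isCompact_closedBall z₀ r)).exists_bound_of_continuousOn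
    (hf.continuousOn.mono (union_subset hKU hrU))
  obtain ⟨M', hM'⟩ := (isCompact_closedBall z₀ r).exists_bound_of_continuousOn
    ((hf.deriv hU).continuousOn.mono hrU)
  refine ⟨r / 2, half_pos hr, ((Metric.ball_subset_ball (half_le_self hr.le)).trans
    Metric.ball_subset_closedBall).trans hrU, max M' ((M + M) / (r / 2)), fun z hz w hw => ?_⟩
  have hz' : z ∈ Metric.closedBall z₀ r :=
    Metric.ball_subset_closedBall (Metric.ball_subset_ball (half_le_self hr.le) hz)
  by_cases hwr : w ∈ Metric.closedBall z₀ r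
  · refine le_max_of_le_left ?_
    rcases eq_or_ne z w with rfl | hne
    · rw [dslope_same]
      exact hM' _ hz'
    · rw [dslope_of_ne _ hne, slope, vsub_eq_sub, norm_smul, norm_inv, inv_mul_le_iff₀
        (norm_pos_iff.2 (sub_ne_zero.2 hne)), mul_comm]
      exact (convex_closedBall z₀ r).norm_image_sub_le_of_norm_deriv_le
        (fun x hx => hf.differentiableAt (hU.mem_nhds (hrU hx))) hM' hwr hz'
  · refine le_max_of_le_right ?_
    rw [Metric.mem_closedBall, not_le] at hwr
    rw [Metric.mem_ball] at hz
    have hd : r / 2 ≤ ‖z - w‖ := by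
      rw [← dist_eq_norm]
      linarith [dist_triangle w z z₀, dist_comm w z]
    have hne : z ≠ w := by
      rintro rfl
      linarith
    rw [dslope_of_ne _ hne, slope, vsub_eq_sub, norm_smul, norm_inv, ← div_eq_inv_mul]
    have hn := (norm_sub_le (f z) (f w)).trans
      (add_le_add (hM z (Or.inr hz')) (hM w (Or.inl hw)))
    have : 0 ≤ M + M := (norm_nonneg _).trans hn
    gcongr

lemma dslope_comm {f : ℂ → ℂ} (a b : ℂ) : dslope f a b = dslope f b a := by
  rcases eq_or_ne a b with rfl | h
  · rfl
  · rw [dslope_of_ne _ h, dslope_of_ne _ h.symm, slope_comm]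

namespace IsRectifiableLoop

variable {γ : ℝ → ℂ} (hγ : IsRectifiableLoop γ)

include hγ

lemma integrable_norm_mul_const (c : ℝ) : MeasureTheory.Integrable (fun t => c * ‖deriv γ t‖)
    (MeasureTheory.volume.restrict (Ioc 0 1)) := by
  have h := hγ.integrable
  rw [intervalIntegrable_iff_integrableOn_Ioc_of_le zero_le_one] at h
  exact h.norm.const_mul c

/-- Contour integrals of functions that depend holomorphically on a parameter are holomorphic. -/
lemma differentiableAt_contourIntegral {G : ℂ → ℂ → ℂ} {z₀ : ℂ} {R C : ℝ} (hR : 0 < R)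
    (hcont : ∀ z ∈ Metric.ball z₀ R, ContinuousOn (G z) (γ '' Icc 0 1))
    (hdiff : ∀ w ∈ γ '' Icc 0 1, DifferentiableOn ℂ (fun z => G z w) (Metric.ball z₀ R))
    (hbound : ∀ z ∈ Metric.ball z₀ R, ∀ w ∈ γ '' Icc 0 1, ‖G z w‖ ≤ C) :
    DifferentiableAt ℂ (fun z => contourIntegral (G z) γ) z₀ := by
  simp only [contourIntegral, intervalIntegral.integral_of_le zero_le_one]
  refine differentiableAt_integral_of_dominated hR (bound := fun t => C * ‖deriv γ t‖)
    (fun z hz => ?_) ?_ ?_ (hγ.integrable_norm_mul_const C)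
  · have h := hγ.integrable_comp_mul (hcont z hz)
    rw [intervalIntegrable_iff_integrableOn_Ioc_of_le zero_le_one] at h
    exact h.aestronglyMeasurable
  · refine (MeasureTheory.ae_restrict_mem measurableSet_Ioc).mono fun t ht => ?_
    exact (hdiff _ (mem_image_of_mem γ (Ioc_subset_Icc_self ht))).mul_const _
  · refine (MeasureTheory.ae_restrict_mem measurableSet_Ioc).mono fun t ht z hz => ?_
    rw [norm_mul]
    gcongr
    exact hbound z hz _ (mem_image_of_mem γ (Ioc_subset_Icc_self ht))

/-- The Cauchy transform of a continuous function on a curve is holomorphic off the curve. -/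
lemma differentiableAt_cauchyTransform {f : ℂ → ℂ} (hf : ContinuousOn f (γ '' Icc 0 1)) {z₀ : ℂ}
    (hz₀ : z₀ ∉ γ '' Icc 0 1) :
    DifferentiableAt ℂ (fun z => contourIntegral (fun w => f w * (w - z)⁻¹) γ) z₀ := by
  obtain ⟨r, hr, hball⟩ := Metric.isOpen_iff.1 hγ.isCompact_image.isClosed.isOpen_compl z₀ hz₀
  obtain ⟨M, hM⟩ := hγ.isCompact_image.exists_bound_of_continuousOn hf
  have hsub : ∀ z ∈ Metric.ball z₀ (r / 2), z ∉ γ '' Icc 0 1 := fun z hz =>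
    hball (Metric.ball_subset_ball (half_le_self hr.le) hz)
  refine hγ.differentiableAt_contourIntegral (C := M * (r / 2)⁻¹) (half_pos hr)
    (fun z hz => hf.mul (continuousOn_sub_inv (hsub z hz))) (fun w hw z hz => ?_)
    fun z hz w hw => ?_
  · have : w - z ≠ 0 := sub_ne_zero.2 (ne_of_mem_of_not_mem hw (hsub z hz))
    exact (((differentiableAt_id.const_sub w).fun_inv this).const_mul _).differentiableWithinAt
  · have h : r ≤ dist w z₀ := by
      by_contra! h
      exact hball h hw
    rw [Metric.mem_ball] at hz
    have : r / 2 ≤ ‖w - z‖ := by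
      rw [← dist_eq_norm]
      linarith [dist_triangle w z z₀]
    have := (norm_nonneg _).trans (hM w hw)
    rw [norm_mul, norm_inv]
    gcongr
    exact hM w hw

lemma tendsto_cauchyTransform_cocompact {f : ℂ → ℂ} (hf : ContinuousOn f (γ '' Icc 0 1)) :
    Tendsto (fun z => contourIntegral (fun w => f w * (w - z)⁻¹) γ) (cocompact ℂ) (𝓝 0) := by
  obtain ⟨M, hM⟩ := hγ.isCompact_image.exists_bound_of_continuousOn hf
  obtain ⟨M', hM'⟩ := hγ.isCompact_image.exists_bound_of_continuousOn continuousOn_id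
  have hlim : Tendsto (fun z : ℂ => (∫ t in (0 : ℝ)..1, M * ‖deriv γ t‖) * (‖z‖ - M')⁻¹)
      (cocompact ℂ) (𝓝 0) := by
    have h : Tendsto (fun z : ℂ => (‖z‖ - M')⁻¹) (cocompact ℂ) (𝓝 0) :=
      (tendsto_atTop_add_const_right _ _ (tendsto_norm_cocompact_atTop (E := ℂ))).inv_tendsto_atTop
    simpa using h.const_mul (∫ t in (0 : ℝ)..1, M * ‖deriv γ t‖)
  refine squeeze_zero_norm' ?_ hlim
  filter_upwards [(tendsto_norm_cocompact_atTop (E := ℂ)).eventually_gt_atTop M'] with z hz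
  rw [contourIntegral, ← intervalIntegral.integral_mul_const]
  have hint := hγ.integrable_norm_mul_const M
  refine intervalIntegral.norm_integral_le_of_norm_le zero_le_one
    (Eventually.of_forall fun t ht => ?_) ?_
  · have hmem := mem_image_of_mem γ (Ioc_subset_Icc_self ht)
    have h1 := hM _ hmem
    have h2 := hM' _ hmem
    have h3 : ‖z‖ - M' ≤ ‖γ t - z‖ := by
      have := norm_sub_norm_le z (γ t)
      rw [norm_sub_rev] at this
      simp only [id] at h2
      linarith
    have h4 : 0 < ‖z‖ - M' := sub_pos.2 hz
    have h5 := (norm_nonneg _).trans h1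
    rw [norm_mul, norm_mul, norm_inv, mul_right_comm]
    gcongr
  · rw [intervalIntegrable_iff_integrableOn_Ioc_of_le zero_le_one]
    exact hint.mul_const _

/-- **Cauchy's integral formula**, homology version. -/
theorem cauchyTransform_eq {f : ℂ → ℂ} {U C : Set ℂ} (hU : IsOpen U)
    (hf : DifferentiableOn ℂ f U) (hγC : γ '' Icc 0 1 ⊆ C) (hC : IsCompact C) (hCU : C ⊆ U)
    (hwind : ∀ w ∉ C, windingIntegral γ w = 0) {a : ℂ} (ha : a ∈ U) (haγ : a ∉ γ '' Icc 0 1) :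
    contourIntegral (fun w => f w * (w - a)⁻¹) γ = windingIntegral γ a * f a := by
  classical
  have hγU := hγC.trans hCU
  have hfγ : ContinuousOn f (γ '' Icc 0 1) := hf.continuousOn.mono hγU
  have hformula : ∀ z ∉ γ '' Icc 0 1, contourIntegral (fun w => dslope f w z) γ =
      contourIntegral (fun w => f w * (w - z)⁻¹) γ - windingIntegral γ z * f z := by
    intro z hz
    rw [windingIntegral, ← contourIntegral_mul_const, ← hγ.contourIntegral_sub
      (hfγ.fun_mul (continuousOn_sub_inv hz))
      ((continuousOn_sub_inv hz).fun_mul continuousOn_const)]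
    refine contourIntegral_congr fun w hw => ?_
    have hne : z ≠ w := (ne_of_mem_of_not_mem hw hz).symm
    have : w - z ≠ 0 := sub_ne_zero.2 hne.symm
    have h2 : z - w ≠ 0 := sub_ne_zero.2 hne
    simp only [dslope_of_ne _ hne, slope, vsub_eq_sub, smul_eq_mul]
    rw [← neg_sub w z, inv_neg]
    ring
  -- Dixon's function: off `C` the winding integral vanishes and both branches agree, so `H` is
  -- entire. It tends to 0 at infinity, so it is zero by Liouville, which is the formula.
  set H : ℂ → ℂ := fun z => if z ∈ U then contourIntegral (fun w => dslope f w z) γ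
    else contourIntegral (fun w => f w * (w - z)⁻¹) γ with hH
  have hHC : ∀ z ∉ C, H z = contourIntegral (fun w => f w * (w - z)⁻¹) γ := by
    intro z hz
    simp only [hH]
    split_ifs
    · rw [hformula z fun h => hz (hγC h), hwind z hz, zero_mul, sub_zero]
    · rfl
  have hHdiff : Differentiable ℂ H := by
    intro z
    by_cases hz : z ∈ U
    · obtain ⟨R, hR, hRU, B, hB⟩ :=
        exists_ball_norm_dslope_le hU hf hγ.isCompact_image hγU hz
      have hd := hγ.differentiableAt_contourIntegral (G := fun z w => dslope f w z) hR
        (fun x hx => ?_) (fun w hw => ?_) hB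
      · refine hd.congr_of_eventuallyEq ?_
        filter_upwards [hU.mem_nhds hz] with x hx
        simp [hH, hx]
      · simp only [dslope_comm _ x]
        exact (((continuousOn_dslope (hU.mem_nhds (hRU hx))).2 ⟨hf.continuousOn,
          hf.differentiableAt (hU.mem_nhds (hRU hx))⟩)).mono hγU
      · exact ((Complex.differentiableOn_dslope (hU.mem_nhds (hγU hw))).2 hf).mono hRU
    · have hzC : z ∉ C := fun h => hz (hCU h)
      refine (hγ.differentiableAt_cauchyTransform hfγ fun h => hzC (hγC h)).congr_of_eventuallyEq ?_
      filter_upwards [hC.isClosed.isOpen_compl.mem_nhds hzC] with x hx using hHC x hx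
  have hHlim : Tendsto H (cocompact ℂ) (𝓝 0) := by
    refine (hγ.tendsto_cauchyTransform_cocompact hfγ).congr' ?_
    filter_upwards [hC.compl_mem_cocompact] with z hz using (hHC z hz).symm
  have h0 : H a = 0 := hHdiff.apply_eq_of_tendsto_cocompact a hHlim
  simp only [hH, if_pos ha] at h0
  rwa [hformula a haγ, sub_eq_zero] at h0

/-- **Cauchy's theorem**, homology version. -/
theorem contourIntegral_eq_zero {f : ℂ → ℂ} {U C : Set ℂ} (hU : IsOpen U)
    (hf : DifferentiableOn ℂ f U) (hγC : γ '' Icc 0 1 ⊆ C) (hC : IsCompact C) (hCU : C ⊆ U)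
    (hwind : ∀ w ∉ C, windingIntegral γ w = 0) (hne : (U \ γ '' Icc 0 1).Nonempty) :
    contourIntegral f γ = 0 := by
  obtain ⟨a, ha, haγ⟩ := hne
  -- The integral formula for f(w)(w - a): its value at `a` is 0, and the Cauchy kernel cancels the
  -- added factor on the curve.
  have h := hγ.cauchyTransform_eq hU (hf.mul ((differentiable_id.sub_const a).differentiableOn))
    hγC hC hCU hwind ha haγ
  simp only [Pi.mul_apply, id, sub_self, mul_zero] at h
  rw [← h]
  refine contourIntegral_congr fun w hw => ?_
  have : w - a ≠ 0 := sub_ne_zero.2 (ne_of_mem_of_not_mem hw haγ)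
  field_simp

end IsRectifiableLoop

/-! ### The jump of the winding number across the curve -/

lemma log_neg_of_im_pos {u : ℂ} (hu : 0 < u.im) :
    Complex.log (-u) = Complex.log u - Real.pi * Complex.I := by
  rw [Complex.log, Complex.log, norm_neg, Complex.arg_neg_eq_arg_sub_pi_of_im_pos hu]
  push_cast
  ring

lemma log_neg_of_im_neg {u : ℂ} (hu : u.im < 0) :
    Complex.log (-u) = Complex.log u + Real.pi * Complex.I := by
  rw [Complex.log, Complex.log, norm_neg, Complex.arg_neg_eq_arg_add_pi_of_im_neg hu]
  push_cast
  ring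

namespace IsRectifiableLoop

variable {γ : ℝ → ℂ} (hγ : IsRectifiableLoop γ)

include hγ

lemma intervalIntegrable_inv_mul {c d : ℝ} (hc : 0 ≤ c) (hcd : c ≤ d) (hd : d ≤ 1) {w : ℂ}
    (hw : w ∉ γ '' Icc c d) :
    IntervalIntegrable (fun t => (γ t - w)⁻¹ * deriv γ t) MeasureTheory.volume c d := by
  refine (hγ.integrable.mono_set ?_).continuousOn_mul ?_
  · rw [uIcc_of_le hcd, uIcc_of_le zero_le_one]
    exact Icc_subset_Icc hc hd
  · rw [uIcc_of_le hcd]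
    exact (continuousOn_sub_inv hw).comp hγ.continuous.continuousOn (mapsTo_image _ _)

lemma continuousAt_integral_inv_mul {c d : ℝ} (hc : 0 ≤ c) (hcd : c ≤ d) (hd : d ≤ 1) {w₀ : ℂ}
    (hw₀ : w₀ ∉ γ '' Icc c d) :
    ContinuousAt (fun w => ∫ t in c..d, (γ t - w)⁻¹ * deriv γ t) w₀ := by
  have hK : IsCompact (γ '' Icc c d) := isCompact_Icc.image hγ.continuous
  obtain ⟨r, hr, hball⟩ := Metric.isOpen_iff.1 hK.isClosed.isOpen_compl w₀ hw₀
  have hsub : ∀ w ∈ Metric.ball w₀ (r / 2), w ∉ γ '' Icc c d := fun w hw =>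
    hball (Metric.ball_subset_ball (half_le_self hr.le) hw)
  have hnhds := Metric.ball_mem_nhds w₀ (half_pos hr)
  refine intervalIntegral.continuousAt_of_dominated_interval
    (bound := fun t => (r / 2)⁻¹ * ‖deriv γ t‖) ?_ ?_ ?_ ?_
  · filter_upwards [hnhds] with w hw
    exact ((hγ.intervalIntegrable_inv_mul hc hcd hd (hsub w hw)).def').aestronglyMeasurable
  · filter_upwards [hnhds] with w hw
    refine Eventually.of_forall fun t ht => ?_
    rw [uIoc_of_le hcd] at ht
    have hmem := mem_image_of_mem γ (Ioc_subset_Icc_self ht)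
    have h : r ≤ dist (γ t) w₀ := by
      by_contra! h
      exact hball h hmem
    rw [Metric.mem_ball] at hw
    have : r / 2 ≤ ‖γ t - w‖ := by
      rw [← dist_eq_norm]
      linarith [dist_triangle (γ t) w w₀]
    rw [norm_mul, norm_inv]
    gcongr
  · refine ((hγ.integrable.mono_set ?_).norm).const_mul _
    rw [uIcc_of_le hcd, uIcc_of_le zero_le_one]
    exact Icc_subset_Icc hc hd
  · refine Eventually.of_forall fun t ht => ?_
    rw [uIoc_of_le hcd] at ht
    have : γ t - w₀ ≠ 0 := fun h =>
      hw₀ (sub_eq_zero.1 h ▸ mem_image_of_mem γ (Ioc_subset_Icc_self ht))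
    exact ((continuousAt_const.sub continuousAt_id).inv₀ this).mul continuousAt_const

/-- The winding number jumps by one when a regular simple point of the curve is crossed from the
right to the left. -/
theorem tendsto_windingIntegral_sub {t₀ : ℝ} (ht₀ : t₀ ∈ Ioo (0 : ℝ) 1) {v : ℂ} (hv : v ≠ 0)
    (hd : HasDerivAt γ v t₀) (hinj : ∀ s ∈ Icc (0 : ℝ) 1, γ s = γ t₀ → s = t₀) :
    Tendsto (fun ε : ℝ => windingIntegral γ (γ t₀ + ε * (Complex.I * v)) -
      windingIntegral γ (γ t₀ - ε * (Complex.I * v))) (𝓝[>] 0)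
      (𝓝 (2 * Real.pi * Complex.I)) := by
  have hv0 : 0 < ‖v‖ := norm_pos_iff.2 hv
  -- Near `t₀` the curve stays in a cone about its tangent. Any fraction of ‖v‖ below 1 would do.
  obtain ⟨δ, hδ, hcone⟩ : ∃ δ > 0, ∀ t ∈ Icc (t₀ - δ) (t₀ + δ), t ∈ Ioo (0 : ℝ) 1 ∧
      ‖γ t - γ t₀ - (t - t₀ : ℝ) • v‖ ≤ ‖v‖ / 4 * ‖t - t₀‖ := by
    have h := (hasDerivAt_iff_isLittleO.1 hd).def (show 0 < ‖v‖ / 4 by positivity)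
    obtain ⟨δ, hδ, h'⟩ := Metric.nhds_basis_closedBall.mem_iff.1
      (inter_mem (isOpen_Ioo.mem_nhds ht₀) h)
    refine ⟨δ, hδ, fun t ht => h' ?_⟩
    rwa [Real.closedBall_eq_Icc]
  set a := t₀ - δ with ha
  set b := t₀ + δ with hb
  have ha0 : 0 < a := (hcone a ⟨le_rfl, by linarith⟩).1.1
  have hb1 : b < 1 := (hcone b ⟨by linarith, le_rfl⟩).1.2
  -- Coordinate in which the point is 0 and the tangent is 1. The cone condition then lets the arc
  -- meet the imaginary axis only at 0.
  set q : ℂ → ℂ := fun z => (z - γ t₀) / v with hq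
  have hqre : ∀ t ∈ Icc a b, |(q (γ t)).re - (t - t₀)| ≤ |t - t₀| / 4 := by
    intro t ht
    have h1 : q (γ t) - (t - t₀ : ℝ) = (γ t - γ t₀ - (t - t₀ : ℝ) • v) / v := by
      simp only [hq, Complex.real_smul]
      field_simp
    have h2 : ‖q (γ t) - (t - t₀ : ℝ)‖ ≤ |t - t₀| / 4 := by
      rw [h1, norm_div, div_le_iff₀ hv0]
      have := (hcone t ht).2
      rw [Real.norm_eq_abs] at this
      linarith
    have h3 := (Complex.abs_re_le_norm _).trans h2
    rwa [Complex.sub_re, Complex.ofReal_re] at h3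
  have hqb : 0 < (q (γ b)).re := by
    have h := abs_le.1 (hqre b ⟨by linarith, le_rfl⟩)
    rw [show b - t₀ = δ by simp [hb], abs_of_pos hδ] at h
    linarith
  have hqa : (q (γ a)).re < 0 := by
    have h := abs_le.1 (hqre a ⟨le_rfl, by linarith⟩)
    rw [show a - t₀ = -δ by simp [ha], abs_neg, abs_of_pos hδ] at h
    linarith
  have hqne : ∀ t ∈ Icc a b, (q (γ t)).re = 0 → q (γ t) = 0 := by
    intro t ht h0
    have h := hqre t ht
    rw [h0, zero_sub, abs_neg] at h
    have : t = t₀ := by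
      have := abs_nonneg (t - t₀)
      exact sub_eq_zero.1 (abs_eq_zero.1 (by linarith))
    simp [hq, this]
  -- Up to the factor I/v, this is γ(t) minus the point at height ε on the left. The arc avoids the
  -- branch cut, so one logarithm serves the whole arc; `hsl2` does the same on the right with -I/v.
  have hsl1 : ∀ ε : ℝ, 0 < ε → ∀ t ∈ Icc a b, (ε : ℂ) + Complex.I * q (γ t) ∈ Complex.slitPlane := by
    intro ε hε t ht
    by_cases h0 : (q (γ t)).re = 0
    · rw [hqne t ht h0]
      simpa using hε
    · exact Or.inr (by simpa using h0)
  have hsl2 : ∀ ε : ℝ, 0 < ε → ∀ t ∈ Icc a b, (ε : ℂ) - Complex.I * q (γ t) ∈ Complex.slitPlane := by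
    intro ε hε t ht
    by_cases h0 : (q (γ t)).re = 0
    · rw [hqne t ht h0]
      simpa using hε
    · exact Or.inr (by simpa using h0)
  -- Contribution of the two far arcs. They miss the simple point `γ t₀`, so `Φ` is continuous there
  -- and cancels in the limit.
  set Φ : ℂ → ℂ := fun w => (∫ t in (0 : ℝ)..a, (γ t - w)⁻¹ * deriv γ t) +
    ∫ t in b..1, (γ t - w)⁻¹ * deriv γ t with hΦ
  have hpa : γ t₀ ∉ γ '' Icc 0 a := by
    rintro ⟨s, hs, h⟩
    have := hinj s ⟨hs.1, by linarith [hs.2]⟩ h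
    linarith [hs.2]
  have hpb : γ t₀ ∉ γ '' Icc b 1 := by
    rintro ⟨s, hs, h⟩
    have := hinj s ⟨by linarith [hs.1], hs.2⟩ h
    linarith [hs.1]
  have hΦc : ContinuousAt Φ (γ t₀) :=
    (hγ.continuousAt_integral_inv_mul le_rfl ha0.le (by linarith) hpa).add
      (hγ.continuousAt_integral_inv_mul (by linarith) hb1.le le_rfl hpb)
  have hab : a ≤ b := by linarith
  have hmid : ∀ (w c : ℂ), c ≠ 0 → (∀ t ∈ Icc a b, c * (γ t - w) ∈ Complex.slitPlane) →
      ∫ t in a..b, (γ t - w)⁻¹ * deriv γ t =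
        Complex.log (c * (γ b - w)) - Complex.log (c * (γ a - w)) := by
    intro w c hc hs
    have hne : ∀ t ∈ Icc a b, γ t - w ≠ 0 := fun t ht h =>
      Complex.slitPlane_ne_zero (hs t ht) (by rw [h, mul_zero])
    refine hγ.integral_eq_sub (f := fun z => (z - w)⁻¹) (F := fun z => Complex.log (c * (z - w)))
      ha0.le hab hb1.le (continuousOn_sub_inv ?_) fun t ht => ?_
    · rintro ⟨t, ht, h⟩
      exact hne t ht (sub_eq_zero.2 h)
    · have := hne t ht
      convert (((hasDerivAt_id' (γ t)).sub_const w).const_mul c).clog (hs t ht) using 1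
      rw [mul_one, ← div_div, div_self hc, one_div]
  have hsplit : ∀ (w c : ℂ), c ≠ 0 → (∀ t ∈ Icc a b, c * (γ t - w) ∈ Complex.slitPlane) →
      w ∉ γ '' Icc 0 a → w ∉ γ '' Icc b 1 → windingIntegral γ w = Φ w +
        (Complex.log (c * (γ b - w)) - Complex.log (c * (γ a - w))) := by
    intro w c hc hs hwa hwb
    have i1 := hγ.intervalIntegrable_inv_mul le_rfl ha0.le (by linarith) hwa
    have i3 := hγ.intervalIntegrable_inv_mul (by linarith) hb1.le le_rfl hwb
    have i2 := hγ.intervalIntegrable_inv_mul ha0.le hab hb1.le (w := w) (by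
      rintro ⟨t, ht, h⟩
      exact Complex.slitPlane_ne_zero (hs t ht) (by rw [h, sub_self, mul_zero]))
    rw [← hmid w c hc hs, windingIntegral, contourIntegral,
      ← intervalIntegral.integral_add_adjacent_intervals (i1.trans i2) i3,
      ← intervalIntegral.integral_add_adjacent_intervals i1 i2]
    simp only [hΦ]
    ring
  have hlimw : ∀ c : ℂ, Tendsto (fun ε : ℝ => γ t₀ + ε * c) (𝓝[>] 0) (𝓝 (γ t₀)) := by
    intro c
    have : Continuous fun ε : ℝ => γ t₀ + ε * c := by fun_prop
    have h := this.tendsto 0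
    simp only [Complex.ofReal_zero, zero_mul, add_zero] at h
    exact h.mono_left nhdsWithin_le_nhds
  have hfar : ∀ c : ℂ, ∀ᶠ ε : ℝ in 𝓝[>] 0, γ t₀ + ε * c ∉ γ '' Icc 0 a ∧
      γ t₀ + ε * c ∉ γ '' Icc b 1 := by
    intro c
    exact (hlimw c).eventually (inter_mem
      ((isCompact_Icc.image hγ.continuous).isClosed.isOpen_compl.mem_nhds hpa)
      ((isCompact_Icc.image hγ.continuous).isClosed.isOpen_compl.mem_nhds hpb))
  set u := Complex.I * q (γ b) with hu
  set u' := Complex.I * q (γ a) with hu'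
  have huim : 0 < u.im := by simpa [hu] using hqb
  have hu'im : u'.im < 0 := by simpa [hu'] using hqa
  have hkey : ∀ᶠ ε : ℝ in 𝓝[>] 0, windingIntegral γ (γ t₀ + ε * (Complex.I * v)) -
      windingIntegral γ (γ t₀ - ε * (Complex.I * v)) =
      Φ (γ t₀ + ε * (Complex.I * v)) - Φ (γ t₀ + ε * (-(Complex.I * v))) +
      ((Complex.log (ε + u) - Complex.log (ε + u')) -
        (Complex.log (ε + -u) - Complex.log (ε + -u'))) := by
    filter_upwards [hfar (Complex.I * v), hfar (-(Complex.I * v)), self_mem_nhdsWithin]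
      with ε h1 h2 hε
    have e1 : ∀ z, Complex.I / v * (z - (γ t₀ + ε * (Complex.I * v))) =
        ε + Complex.I * q z := by
      intro z
      simp only [hq]
      field_simp
      linear_combination (-ε * v : ℂ) * Complex.I_sq
    have e2 : ∀ z, -(Complex.I / v) * (z - (γ t₀ + ε * -(Complex.I * v))) =
        ε - Complex.I * q z := by
      intro z
      simp only [hq]
      field_simp
      linear_combination (-ε * v : ℂ) * Complex.I_sq
    have hc : Complex.I / v ≠ 0 := div_ne_zero Complex.I_ne_zero hv
    rw [sub_eq_add_neg (γ t₀), ← mul_neg, hsplit _ _ hc (fun t ht => e1 _ ▸ hsl1 ε hε t ht) h1.1 h1.2,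
      hsplit _ _ (neg_ne_zero.2 hc) (fun t ht => e2 _ ▸ hsl2 ε hε t ht) h2.1 h2.2,
      e1, e1, e2, e2]
    simp only [sub_eq_add_neg]
    ring
  have hlog : ∀ x : ℂ, x.im ≠ 0 →
      Tendsto (fun ε : ℝ => Complex.log (ε + x)) (𝓝[>] 0) (𝓝 (Complex.log x)) := by
    intro x hx
    have h0 : ContinuousAt (fun ε : ℝ => Complex.log (ε + x)) 0 :=
      ContinuousAt.clog (by fun_prop) (Or.inr (by simpa using hx))
    have h := h0.tendsto
    simp only [Complex.ofReal_zero, zero_add] at h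
    exact h.mono_left nhdsWithin_le_nhds
  refine Tendsto.congr' (hkey.mono fun _ h => h.symm) ?_
  have hlim := ((hΦc.tendsto.comp (hlimw (Complex.I * v))).sub
    (hΦc.tendsto.comp (hlimw (-(Complex.I * v))))).add
    (((hlog u huim.ne').sub (hlog u' hu'im.ne)).sub
      ((hlog (-u) (by simpa using huim.ne')).sub (hlog (-u') (by simpa using hu'im.ne))))
  -- The ends of the short arc lie on opposite sides of the normal line, and each change of sign
  -- inside the logarithm contributes πi.
  have hval : Φ (γ t₀) - Φ (γ t₀) + ((Complex.log u - Complex.log u') -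
      (Complex.log (-u) - Complex.log (-u'))) = 2 * Real.pi * Complex.I := by
    rw [log_neg_of_im_pos huim, log_neg_of_im_neg hu'im]
    ring
  rwa [hval] at hlim

end IsRectifiableLoop

/-! ### Regularity of a positive boundary -/

/-- Every point is the left end of an open interval that misses a given finite set. -/
lemma exists_Ioo_disjoint_right {S : Set ℝ} (hS : S.Finite) (t : ℝ) {c : ℝ} (htc : t < c) :
    ∃ b, t < b ∧ b ≤ c ∧ Disjoint (Ioo t b) S := by
  have hn : (S \ {t})ᶜ ∈ 𝓝 t :=
    (hS.subset sdiff_subset).isClosed.isOpen_compl.mem_nhds (by simp)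
  obtain ⟨ε, hε, h⟩ := Metric.mem_nhds_iff.1 hn
  refine ⟨min (t + ε) c, lt_min (by linarith) htc, min_le_right _ _, ?_⟩
  refine disjoint_left.2 fun s hs hsS => h ?_ ⟨hsS, hs.1.ne'⟩
  rw [Real.ball_eq_Ioo]
  exact ⟨by linarith [hs.1], hs.2.trans_le (min_le_left _ _)⟩

lemma exists_Ioo_disjoint_left {S : Set ℝ} (hS : S.Finite) (t : ℝ) {c : ℝ} (hct : c < t) :
    ∃ a, c ≤ a ∧ a < t ∧ Disjoint (Ioo a t) S := by
  have hn : (S \ {t})ᶜ ∈ 𝓝 t :=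
    (hS.subset sdiff_subset).isClosed.isOpen_compl.mem_nhds (by simp)
  obtain ⟨ε, hε, h⟩ := Metric.mem_nhds_iff.1 hn
  refine ⟨max (t - ε) c, le_max_right _ _, max_lt (by linarith) hct, ?_⟩
  refine disjoint_left.2 fun s hs hsS => h ?_ ⟨hsS, hs.2.ne⟩
  rw [Real.ball_eq_Ioo]
  exact ⟨(le_max_left _ _).trans_lt hs.1, by linarith [hs.2]⟩

lemma norm_deriv_le_of_contDiffOn_Icc {γ : ℝ → ℂ} {a b : ℝ} (hab : a < b)
    (h : ContDiffOn ℝ 1 γ (Icc a b)) : ∃ C, ∀ t ∈ Ioo a b, ‖deriv γ t‖ ≤ C := by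
  obtain ⟨C, hC⟩ := isCompact_Icc.exists_bound_of_continuousOn
    (h.continuousOn_derivWithin (uniqueDiffOn_Icc hab) le_rfl)
  refine ⟨C, fun t ht => ?_⟩
  rw [← derivWithin_of_mem_nhds (Icc_mem_nhds ht.1 ht.2)]
  exact hC t (Ioo_subset_Icc_self ht)

namespace IsPositiveBoundary

variable {Ω : Set ℂ} {γ : ℝ → ℂ}

/-- Each parameter has one-sided intervals free of break points, on which the derivative is bounded.
The value at the parameter itself joins the maximum, and compactness glues the local bounds. -/
lemma exists_norm_deriv_le (hγ : IsPositiveBoundary Ω γ) :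
    ∃ C, ∀ t ∈ Icc (0 : ℝ) 1, ‖deriv γ t‖ ≤ C := by
  obtain ⟨S, hS, -, -, hC1, -, -⟩ := hγ.piecewise_smooth
  refine isCompact_Icc.induction_on (p := fun s => ∃ C, ∀ t ∈ s, t ∈ Icc (0 : ℝ) 1 → ‖deriv γ t‖ ≤ C)
    ?_ ?_ ?_ ?_ |>.imp fun C hC t ht => hC t ht ht
  · exact ⟨0, by simp⟩
  · exact fun s s' hss' ⟨C, hC⟩ => ⟨C, fun t ht => hC t (hss' ht)⟩
  · rintro s s' ⟨C, hC⟩ ⟨C', hC'⟩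
    exact ⟨max C C', fun t ht h => ht.elim (fun ht => le_max_of_le_left (hC t ht h))
      fun ht => le_max_of_le_right (hC' t ht h)⟩
  · intro t ht
    have hright : ∃ b > t, ∃ C, ∀ s ∈ Ioo t b, s ∈ Icc (0 : ℝ) 1 → ‖deriv γ s‖ ≤ C := by
      rcases ht.2.eq_or_lt with rfl | h
      · exact ⟨2, by norm_num, 0, fun s hs h => absurd hs.1 (not_lt.2 h.2)⟩
      · obtain ⟨b, htb, hb1, hbS⟩ := exists_Ioo_disjoint_right hS t h
        obtain ⟨C, hC⟩ := norm_deriv_le_of_contDiffOn_Icc htb (hC1 t b ht.1 htb hb1 hbS).1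
        exact ⟨b, htb, C, fun s hs _ => hC s hs⟩
    have hleft : ∃ a < t, ∃ C, ∀ s ∈ Ioo a t, s ∈ Icc (0 : ℝ) 1 → ‖deriv γ s‖ ≤ C := by
      rcases ht.1.eq_or_lt with rfl | h
      · exact ⟨-1, by norm_num, 0, fun s hs h => absurd hs.2 (not_lt.2 h.1)⟩
      · obtain ⟨a, ha0, hat, haS⟩ := exists_Ioo_disjoint_left hS t h
        obtain ⟨C, hC⟩ := norm_deriv_le_of_contDiffOn_Icc hat (hC1 a t ha0 hat ht.2 haS).1
        exact ⟨a, hat, C, fun s hs _ => hC s hs⟩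
    obtain ⟨b, htb, C, hC⟩ := hright
    obtain ⟨a, hat, C', hC'⟩ := hleft
    refine ⟨Ioo a b, mem_nhdsWithin_of_mem_nhds (Ioo_mem_nhds hat htb),
      max (max C C') ‖deriv γ t‖, fun s hs h => ?_⟩
    rcases lt_trichotomy s t with hst | rfl | hst
    · exact le_max_of_le_left (le_max_of_le_right (hC' s ⟨hs.1, hst⟩ h))
    · exact le_max_right _ _
    · exact le_max_of_le_left (le_max_of_le_left (hC s ⟨hst, hs.2⟩ h))

/-- The parametrization is regular at each parameter that is not a break point, the corresponding
boundary point is simple, and `Ω` lies to its left. -/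
lemma exists_finite_regular (hγ : IsPositiveBoundary Ω γ) : ∃ S : Set ℝ, S.Finite ∧
    ∀ t ∈ Icc (0 : ℝ) 1 \ S, t ∈ Ioo (0 : ℝ) 1 ∧ HasDerivAt γ (deriv γ t) t ∧ deriv γ t ≠ 0 ∧
      (∀ s ∈ Icc (0 : ℝ) 1, γ s = γ t → s = t) ∧
      ∀ᶠ ε : ℝ in 𝓝[>] 0, γ t + (ε : ℂ) * (Complex.I * deriv γ t) ∈ Ω := by
  obtain ⟨S, hS, h0, h1, hC1, hinj, hleft⟩ := hγ.piecewise_smooth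
  refine ⟨S, hS, fun t ht => ?_⟩
  have ht01 : t ∈ Ioo (0 : ℝ) 1 := ⟨ht.1.1.lt_of_ne fun h => ht.2 (h ▸ h0),
    ht.1.2.lt_of_ne fun h => ht.2 (h ▸ h1)⟩
  obtain ⟨a, ha0, hat, haS⟩ := exists_Ioo_disjoint_left hS t ht01.1
  obtain ⟨b, htb, hb1, hbS⟩ := exists_Ioo_disjoint_right hS t ht01.2
  have hd : Disjoint (Ioo a b) S := by
    refine disjoint_left.2 fun s hs hsS => ?_
    rcases lt_trichotomy s t with hst | rfl | hst
    · exact disjoint_left.1 haS ⟨hs.1, hst⟩ hsS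
    · exact ht.2 hsS
    · exact disjoint_left.1 hbS ⟨hst, hs.2⟩ hsS
  obtain ⟨hcd, hne⟩ := hC1 a b ha0 (hat.trans htb) hb1 hd
  have hn : Icc a b ∈ 𝓝 t := Icc_mem_nhds hat htb
  refine ⟨ht01, ?_, ?_, hinj t ht, hleft t ht⟩
  · exact ((hcd.contDiffAt hn).differentiableAt one_ne_zero).hasDerivAt
  · rw [← derivWithin_of_mem_nhds hn]
    exact hne t ⟨hat.le, htb.le⟩

lemma isRectifiableLoop (hγ : IsPositiveBoundary Ω γ) : IsRectifiableLoop γ where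
  continuous := hγ.continuous
  closed := by simpa using (hγ.periodic 0).symm
  exists_hasDerivAt := by
    obtain ⟨S, hS, h⟩ := hγ.exists_finite_regular
    exact ⟨S, hS.countable, fun t ht =>
      (h t ⟨Ioo_subset_Icc_self ht.1, ht.2⟩).2.1.differentiableAt⟩
  integrable := by
    obtain ⟨C, hC⟩ := hγ.exists_norm_deriv_le
    rw [intervalIntegrable_iff_integrableOn_Ioc_of_le zero_le_one]
    exact MeasureTheory.Measure.integrableOn_of_bounded (by simp)
      (measurable_deriv γ).aestronglyMeasurable
      ((MeasureTheory.ae_restrict_mem measurableSet_Ioc).mono fun t ht =>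
        hC t (Ioc_subset_Icc_self ht))

/-! ### Winding numbers inside and outside the domain -/

/-- If the point of `closure Ω` nearest to `w` is a regular boundary point, then `w` lies on the
right normal ray there, and the winding numbers around `w` and around the points of `Ω` differ
by one. -/
lemma windingIntegral_eq_of_nearest (hγ : IsPositiveBoundary Ω γ) (hΩ : IsPreconnected Ω)
    (hΩo : IsOpen Ω) {t : ℝ} (ht : t ∈ Ioo (0 : ℝ) 1) (hd : HasDerivAt γ (deriv γ t) t)
    (hne : deriv γ t ≠ 0) (hinj : ∀ s ∈ Icc (0 : ℝ) 1, γ s = γ t → s = t)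
    (hleft : ∀ᶠ ε : ℝ in 𝓝[>] 0, γ t + (ε : ℂ) * (Complex.I * deriv γ t) ∈ Ω) {w : ℂ}
    (hw : w ∉ closure Ω) (hnear : ∀ z ∈ closure Ω, ‖γ t - w‖ ≤ ‖z - w‖) {a : ℂ} (ha : a ∈ Ω) :
    windingIntegral γ a = windingIntegral γ w + 2 * Real.pi * Complex.I := by
  have hloop := hγ.isRectifiableLoop
  have himage : ∀ s ∈ Icc (0 : ℝ) 1, γ s ∈ closure Ω := fun s hs =>
    frontier_subset_closure (hγ.image_eq ▸ mem_image_of_mem γ hs)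
  have hpw : γ t ≠ w := fun h => hw (h ▸ himage t (Ioo_subset_Icc_self ht))
  set v := deriv γ t with hv
  -- the segment from `w` to its nearest point misses `closure Ω`
  have hseg : ∀ τ : ℝ, 0 < τ → τ ≤ 1 → γ t + τ * (w - γ t) ∉ closure Ω := by
    intro τ h0 h1 hmem
    have h := hnear _ hmem
    have e : γ t + τ * (w - γ t) - w = ((1 - τ : ℝ) : ℂ) * (γ t - w) := by
      push_cast
      ring
    rw [e, norm_mul, Complex.norm_real, Real.norm_eq_abs, abs_of_nonneg (by linarith)] at h
    nlinarith [norm_pos_iff.2 (sub_ne_zero.2 hpw)]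
  -- by minimality, it is orthogonal to the boundary
  have horth : ((w - γ t) / v).re = 0 := by
    have hmin : IsLocalMin (fun s => ‖γ s - w‖ ^ 2) t := by
      filter_upwards [isOpen_Ioo.mem_nhds ht] with s hs
      have := hnear _ (himage s (Ioo_subset_Icc_self hs))
      gcongr
    have h0 := hmin.hasDerivAt_eq_zero (hd.sub_const w).norm_sq
    have h1 : inner ℝ (γ t - w) v = 0 := by linarith
    rw [Complex.div_re]
    rw [Complex.inner] at h1
    simp only [Complex.mul_re, Complex.conj_re, Complex.conj_im, Complex.sub_re,
      Complex.sub_im] at h1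
    simp only [Complex.sub_re, Complex.sub_im]
    rw [← add_div, div_eq_zero_iff]
    left
    linarith
  obtain ⟨l, hl⟩ : ∃ l : ℝ, w - γ t = l * (Complex.I * v) := by
    refine ⟨((w - γ t) / v).im, ?_⟩
    have h := Complex.re_add_im ((w - γ t) / v)
    rw [horth, Complex.ofReal_zero, zero_add] at h
    rw [← mul_assoc, h, div_mul_cancel₀ _ hne]
  have hlim0 : ∀ r : ℝ, 0 < r → ∀ᶠ ε : ℝ in 𝓝[>] 0, 0 < ε ∧ ε ≤ r := fun r hr => by
    filter_upwards [self_mem_nhdsWithin, nhdsWithin_le_nhds (Iic_mem_nhds hr)] with ε h1 h2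
      using ⟨h1, h2⟩
  -- If `w` lay on the left normal ray, points of the segment close to `γ t` would belong to Ω.
  have hl0 : l < 0 := by
    rcases lt_trichotomy l 0 with h | h | h
    · exact h
    · rw [h, Complex.ofReal_zero, zero_mul, sub_eq_zero] at hl
      exact absurd hl.symm hpw
    · obtain ⟨ε, hε, h0, hεl⟩ := (hleft.and (hlim0 l h)).exists
      refine absurd (subset_closure hε) ?_
      have := hseg (ε / l) (by positivity) ((div_le_one h).2 hεl)
      rwa [hl, ← mul_assoc, Complex.ofReal_div, div_mul_cancel₀ _
        (Complex.ofReal_ne_zero.2 h.ne')] at this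
  have hright : ∀ᶠ ε : ℝ in 𝓝[>] 0,
      windingIntegral γ (γ t - ε * (Complex.I * v)) = windingIntegral γ w := by
    filter_upwards [hlim0 (-l) (neg_pos.2 hl0)] with ε hε
    have hpre : IsPreconnected ((fun τ : ℝ => γ t + τ * (w - γ t)) '' Ioc 0 1) :=
      isPreconnected_Ioc.image _ (by fun_prop)
    refine hloop.windingIntegral_eq_of_isPreconnected hpre ?_
      ⟨ε / (-l), ⟨div_pos hε.1 (by linarith), (div_le_one (by linarith)).2 hε.2⟩, ?_⟩
      ⟨1, ⟨one_pos, le_rfl⟩, by simp⟩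
    · refine disjoint_left.2 ?_
      rintro _ ⟨τ, hτ, rfl⟩ ⟨s, hs, h⟩
      have hmem := himage s hs
      rw [h] at hmem
      exact hseg τ hτ.1 hτ.2 hmem
    · have : (l : ℂ) ≠ 0 := Complex.ofReal_ne_zero.2 hl0.ne
      simp only [hl]
      push_cast
      field_simp
      ring
  have hin : ∀ᶠ ε : ℝ in 𝓝[>] 0,
      windingIntegral γ (γ t + ε * (Complex.I * v)) = windingIntegral γ a := by
    filter_upwards [hleft] with ε hε
    refine hloop.windingIntegral_eq_of_isPreconnected hΩ ?_ hε ha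
    rw [hγ.image_eq, frontier, hΩo.interior_eq]
    exact disjoint_sdiff_right
  have hjump := hloop.tendsto_windingIntegral_sub ht hne hd hinj
  have hconst : Tendsto (fun ε : ℝ => windingIntegral γ (γ t + ε * (Complex.I * v)) -
      windingIntegral γ (γ t - ε * (Complex.I * v))) (𝓝[>] 0)
      (𝓝 (windingIntegral γ a - windingIntegral γ w)) := by
    refine tendsto_const_nhds.congr' ?_
    filter_upwards [hright, hin] with ε h1 h2
    rw [h1, h2]
  rw [tendsto_nhds_unique hjump hconst]
  ring

/-- Let `B` be the open set of exterior points violating the identity. Their nearest points are all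
corners, so the frontier of `B` lies in the finite set `γ '' S`. Its complement is connected and
contains points of Ω, which are not in the closure of `B`; hence `B` is empty. Connectedness of the
exterior is not needed. -/
lemma windingIntegral_eq_of_notMem_closure (hγ : IsPositiveBoundary Ω γ) (hΩ : IsPreconnected Ω)
    (hΩo : IsOpen Ω) {a w : ℂ} (ha : a ∈ Ω) (hw : w ∉ closure Ω) :
    windingIntegral γ a = windingIntegral γ w + 2 * Real.pi * Complex.I := by
  have hloop := hγ.isRectifiableLoop
  obtain ⟨S, hS, hreg⟩ := hγ.exists_finite_regular
  have hfrontier : γ '' Icc 0 1 ⊆ closure Ω := hγ.image_eq ▸ frontier_subset_closure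
  have hlc : ∀ z ∉ closure Ω, ∀ᶠ z' in 𝓝 z, z' ∉ closure Ω ∧
      windingIntegral γ z' = windingIntegral γ z := fun z hz =>
    Eventually.and (isClosed_closure.isOpen_compl.mem_nhds hz)
      (hloop.windingIntegral_eventuallyEq fun h => hz (hfrontier h))
  set B : Set ℂ := {z | z ∉ closure Ω ∧
    windingIntegral γ a ≠ windingIntegral γ z + 2 * Real.pi * Complex.I} with hB
  have hBo : IsOpen B := by
    refine isOpen_iff_mem_nhds.2 fun z hz => ?_
    filter_upwards [hlc z hz.1] with z' hz'
    exact ⟨hz'.1, hz'.2 ▸ hz.2⟩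
  have hF : (γ '' S).Finite := hS.image γ
  have hnearest : ∀ z ∈ B, ∃ p ∈ γ '' S, dist z p = Metric.infDist z (closure Ω) := by
    intro z hz
    have hne : (closure Ω)ᶜ ≠ univ := by
      intro h
      have : a ∈ (closure Ω)ᶜ := h ▸ mem_univ a
      exact this (subset_closure ha)
    obtain ⟨p, hp, hdist⟩ := exists_mem_frontier_infDist_compl_eq_dist hz.1 hne
    rw [compl_compl] at hdist
    rw [frontier_compl] at hp
    have hp' : p ∈ γ '' Icc 0 1 := hγ.image_eq ▸ frontier_closure_subset hp
    obtain ⟨t, ht, rfl⟩ := hp'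
    refine ⟨γ t, ?_, hdist.symm⟩
    by_contra hpS
    obtain ⟨h1, h2, h3, h4, h5⟩ := hreg t ⟨ht, fun h => hpS (mem_image_of_mem γ h)⟩
    refine hz.2 (hγ.windingIntegral_eq_of_nearest hΩ hΩo h1 h2 h3 h4 h5 hz.1 (fun x hx => ?_) ha)
    rw [← dist_eq_norm, ← dist_eq_norm, dist_comm _ z, dist_comm _ z, ← hdist]
    exact Metric.infDist_le_dist_of_mem hx
  have hfr : frontier B ⊆ γ '' S := by
    intro z hz
    rw [frontier, hBo.interior_eq] at hz
    by_cases hzc : z ∈ closure Ω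
    -- A point of `B` within ε/2 of `z` is at least as close to its nearest corner, so that corner
    -- is within ε of `z`.
    · rw [← hF.isClosed.closure_eq, Metric.mem_closure_iff]
      intro ε hε
      obtain ⟨y, hy, hzy⟩ := Metric.mem_closure_iff.1 hz.1 (ε / 2) (half_pos hε)
      obtain ⟨p, hp, hyp⟩ := hnearest y hy
      refine ⟨p, hp, ?_⟩
      have h := Metric.infDist_le_dist_of_mem (x := y) hzc
      linarith [dist_triangle z y p, dist_comm y z]
    · obtain ⟨y, hy, hyB⟩ := mem_closure_iff_nhds.1 hz.1 _ (hlc z hzc)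
      exact absurd ⟨hzc, hy.2 ▸ hyB.2⟩ hz.2
  have hconn : IsPreconnected (γ '' S)ᶜ :=
    (hF.countable.isConnected_compl_of_one_lt_rank (by simp)).isPreconnected
  have hsmall : ∀ V : Set ℂ, IsOpen V → V.Nonempty → ∃ x ∈ V, x ∈ (γ '' S)ᶜ := by
    intro V hV hVne
    obtain ⟨x, hx, hxF⟩ := (hF.countable.dense_compl ℝ).inter_open_nonempty V hV hVne
    exact ⟨x, hx, hxF⟩
  by_contra hcon
  obtain ⟨x, hxB, hxF⟩ := hsmall B hBo ⟨w, hw, hcon⟩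
  obtain ⟨y, hyΩ, hyF⟩ := hsmall Ω hΩo ⟨a, ha⟩
  have hcover : (γ '' S)ᶜ ⊆ B ∪ (closure B)ᶜ := by
    intro z hz
    by_cases h : z ∈ closure B
    · left
      by_contra hzB
      exact hz (hfr ⟨h, by rwa [hBo.interior_eq]⟩)
    · exact Or.inr h
  have hyB : y ∉ closure B := by
    intro h
    obtain ⟨z, hz, hzB⟩ := mem_closure_iff.1 h Ω hΩo hyΩ
    exact hzB.1 (subset_closure hz)
  obtain ⟨z, -, hzB, hzB'⟩ := hconn B (closure B)ᶜ hBo isClosed_closure.isOpen_compl hcover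
    ⟨x, hxF, hxB⟩ ⟨y, hyF, hyB⟩
  exact hzB' (subset_closure hzB)

/-- A positive boundary winds once around the points of the domain. -/
theorem windingIntegral_of_mem (hγ : IsPositiveBoundary Ω γ) (hΩ : IsPreconnected Ω)
    (hΩo : IsOpen Ω) (hΩb : Bornology.IsBounded Ω) {a : ℂ} (ha : a ∈ Ω) :
    windingIntegral γ a = 2 * Real.pi * Complex.I := by
  -- The winding integral is constant off `closure Ω` and tends to 0 at infinity, so that constant
  -- is 0.
  have hlim : Tendsto (windingIntegral γ) (cocompact ℂ) (𝓝 0) := by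
    have h := hγ.isRectifiableLoop.tendsto_cauchyTransform_cocompact
      (f := fun _ => 1) continuousOn_const
    simp only [one_mul] at h
    exact h
  have hconst : Tendsto (windingIntegral γ) (cocompact ℂ)
      (𝓝 (windingIntegral γ a - 2 * Real.pi * Complex.I)) := by
    refine tendsto_const_nhds.congr' ?_
    filter_upwards [hΩb.isCompact_closure.compl_mem_cocompact] with w hw
    rw [hγ.windingIntegral_eq_of_notMem_closure hΩ hΩo ha hw]
    ring
  exact sub_eq_zero.1 (tendsto_nhds_unique hconst hlim)

/-- A positive boundary does not wind around the points outside the domain. -/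
theorem windingIntegral_of_notMem (hγ : IsPositiveBoundary Ω γ) (hΩ : IsPreconnected Ω)
    (hΩo : IsOpen Ω) (hΩb : Bornology.IsBounded Ω) (hne : Ω.Nonempty) {w : ℂ}
    (hw : w ∉ closure Ω) : windingIntegral γ w = 0 := by
  obtain ⟨a, ha⟩ := hne
  have h := hγ.windingIntegral_eq_of_notMem_closure hΩ hΩo ha hw
  rw [hγ.windingIntegral_of_mem hΩ hΩo hΩb ha] at h
  exact right_eq_add.1 h

end IsPositiveBoundary

/-! ### Zeros and their multiplicities -/

/-- The zeros of an analytic function on a compact connected set are finite in number. -/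
lemma AnalyticOnNhd.finite_zeros {φ : ℂ → ℂ} {K : Set ℂ} (hφ : AnalyticOnNhd ℂ φ K)
    (hK : IsCompact K) (hconn : IsPreconnected K) {a : ℂ} (ha : a ∈ K) (hne : φ a ≠ 0) :
    {z ∈ K | φ z = 0}.Finite := by
  by_contra hinf
  obtain ⟨x, hx, hacc⟩ := Set.Infinite.exists_accPt_of_subset_isCompact hinf hK (sep_subset _ _)
  rw [accPt_iff_frequently_nhdsNE] at hacc
  exact hne (hφ.eqOn_zero_of_preconnected_of_frequently_eq_zero hconn hx
    (hacc.mono fun y hy => hy.2) ha)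

/-- **Minimum modulus principle**. -/
lemma exists_zero_of_norm_lt_frontier {Ω : Set ℂ} (hΩb : Bornology.IsBounded Ω)
    (hΩo : IsOpen Ω) {φ : ℂ → ℂ} (hφ : AnalyticOnNhd ℂ φ (closure Ω)) {z₁ : ℂ} (hz₁ : z₁ ∈ Ω)
    (hlt : ∀ z ∈ frontier Ω, ‖φ z₁‖ < ‖φ z‖) : ∃ z₀ ∈ Ω, φ z₀ = 0 := by
  by_contra! hne
  have hne' : ∀ z ∈ closure Ω, φ z ≠ 0 := by
    intro z hz
    by_cases hzΩ : z ∈ Ω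
    · exact hne z hzΩ
    · exact norm_pos_iff.1 ((norm_nonneg _).trans_lt
        (hlt z ⟨hz, by rwa [hΩo.interior_eq]⟩))
  have hd : DiffContOnCl ℂ (fun z => (φ z)⁻¹) Ω :=
    (hφ.differentiableOn.inv hne').diffContOnCl
  obtain ⟨z, hz, hmax⟩ := Complex.exists_mem_frontier_isMaxOn_norm hΩb ⟨z₁, hz₁⟩ hd
  have h := hmax (subset_closure hz₁)
  simp only [mem_ofPred_eq, Function.comp_apply, norm_inv] at h
  rw [inv_le_inv₀ (norm_pos_iff.2 (hne z₁ hz₁))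
    ((norm_nonneg _).trans_lt (hlt z hz))] at h
  exact absurd (hlt z hz) (not_lt.2 h)

lemma zeroCount_eq_zero {φ : ℂ → ℂ} {Ω : Set ℂ} (h : ∀ z ∈ Ω, φ z ≠ 0) : zeroCount φ Ω = 0 := by
  refine finsum_mem_eq_zero_of_forall_eq_zero fun z hz => ?_
  by_contra h'
  exact h z hz (apply_eq_zero_of_analyticOrderNatAt_ne_zero h')

/-- Splitting off a zero lowers the number of zeros by one. -/
lemma zeroCount_sub_mul {ψ : ℂ → ℂ} {Ω : Set ℂ} {a : ℂ} (ha : a ∈ Ω) (hψ : AnalyticOnNhd ℂ ψ Ω)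
    (hfin : {z ∈ Ω | ψ z = 0}.Finite) (htop : ∀ z ∈ Ω, analyticOrderAt ψ z ≠ ⊤) :
    zeroCount (fun z => (z - a) * ψ z) Ω = zeroCount ψ Ω + 1 := by
  have hlin : ∀ z, analyticOrderAt (fun z => z - a) z = if z = a then 1 else 0 := by
    intro z
    split_ifs with h
    · rw [h, analyticOrderAt_id_sub_const_self]
    · exact analyticOrderAt_id_sub_const_of_ne h
  have hlinNat : ∀ z, analyticOrderNatAt (fun z => z - a) z = if z = a then 1 else 0 := by
    intro z
    rw [analyticOrderNatAt, hlin]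
    split_ifs <;> rfl
  have hsum : zeroCount (fun z => (z - a) * ψ z) Ω =
      ∑ᶠ z ∈ Ω, (analyticOrderNatAt ψ z + if z = a then 1 else 0) := by
    refine finsum_mem_congr rfl fun z hz => ?_
    have h := analyticOrderNatAt_mul (f := fun z => z - a) (g := ψ) (z₀ := z) (by fun_prop) (hψ z hz)
      (by rw [hlin]; split_ifs <;> simp) (htop z hz)
    rw [hlinNat, add_comm] at h
    exact h
  -- A `finsum` with infinite support is 0 by default, so splitting it requires both supports to be
  -- finite.
  rw [hsum, finsum_mem_add_distrib', zeroCount]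
  · congr 1
    rw [finsum_eq_single _ a fun x hx => by simp [hx]]
    simp [ha]
  · exact hfin.subset fun z hz => ⟨hz.1, apply_eq_zero_of_analyticOrderNatAt_ne_zero hz.2⟩
  · refine (finite_singleton a).subset fun z hz => ?_
    by_contra h
    exact hz.2 (if_neg h)

/-- At `a` itself this is the removable singularity theorem. -/
lemma AnalyticOnNhd.dslope {φ : ℂ → ℂ} {K : Set ℂ} (hφ : AnalyticOnNhd ℂ φ K) {a : ℂ}
    (ha : a ∈ K) : AnalyticOnNhd ℂ (dslope φ a) K := by
  have hU : IsOpen {z | AnalyticAt ℂ φ z} := isOpen_analyticAt ℂ φ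
  have hd : DifferentiableOn ℂ φ {z | AnalyticAt ℂ φ z} := fun z hz =>
    hz.differentiableAt.differentiableWithinAt
  have h := ((Complex.differentiableOn_dslope (hU.mem_nhds (hφ a ha))).2 hd).analyticOnNhd hU
  exact fun z hz => h z (hφ z hz)

/-! ### The argument principle -/

namespace IsPositiveBoundary

variable {Ω : Set ℂ} {γ : ℝ → ℂ}

/-- **Cauchy's theorem** for the positive boundary of a bounded domain. -/
theorem contourIntegral_eq_zero (hγ : IsPositiveBoundary Ω γ) (hΩ : IsConnected Ω)
    (hΩo : IsOpen Ω) (hΩb : Bornology.IsBounded Ω) {f : ℂ → ℂ}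
    (hf : AnalyticOnNhd ℂ f (closure Ω)) : contourIntegral f γ = 0 := by
  refine hγ.isRectifiableLoop.contourIntegral_eq_zero (isOpen_analyticAt ℂ f)
    (C := closure Ω) (fun z hz => AnalyticAt.differentiableWithinAt hz) ?_ hΩb.isCompact_closure
    hf (fun w hw => hγ.windingIntegral_of_notMem hΩ.isPreconnected hΩo hΩb hΩ.nonempty hw) ?_
  · exact hγ.image_eq ▸ frontier_subset_closure
  · obtain ⟨a, ha⟩ := hΩ.nonempty
    refine ⟨a, hf a (subset_closure ha), ?_⟩
    rw [hγ.image_eq]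
    exact fun h => h.2 (by rwa [hΩo.interior_eq])

lemma frontier_nonempty (hγ : IsPositiveBoundary Ω γ) : (frontier Ω).Nonempty :=
  hγ.image_eq ▸ ⟨γ 0, mem_image_of_mem γ ⟨le_rfl, zero_le_one⟩⟩

lemma finite_zeros (hγ : IsPositiveBoundary Ω γ) (hΩ : IsConnected Ω)
    (hΩb : Bornology.IsBounded Ω) {φ : ℂ → ℂ} (hφ : AnalyticOnNhd ℂ φ (closure Ω))
    (hne : ∀ z ∈ frontier Ω, φ z ≠ 0) : {z ∈ Ω | φ z = 0}.Finite := by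
  obtain ⟨p, hp⟩ := hγ.frontier_nonempty
  exact (hφ.finite_zeros hΩb.isCompact_closure hΩ.isPreconnected.closure
    (frontier_subset_closure hp) (hne p hp)).subset fun z hz => ⟨subset_closure hz.1, hz.2⟩

/-- A nonzero boundary value rules out local vanishing anywhere on the connected closure. This
matters because `analyticOrderNatAt` sends ⊤ to 0. -/
lemma analyticOrderAt_ne_top (hγ : IsPositiveBoundary Ω γ) (hΩ : IsConnected Ω) {φ : ℂ → ℂ}
    (hφ : AnalyticOnNhd ℂ φ (closure Ω)) (hne : ∀ z ∈ frontier Ω, φ z ≠ 0) :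
    ∀ z ∈ closure Ω, analyticOrderAt φ z ≠ ⊤ := by
  obtain ⟨p, hp⟩ := hγ.frontier_nonempty
  refine fun z hz => hφ.analyticOrderAt_ne_top_of_isPreconnected hΩ.isPreconnected.closure
    (frontier_subset_closure hp) hz ?_
  rw [analyticOrderAt_eq_zero.2 (Or.inr (hne p hp))]
  exact ENat.zero_ne_top

lemma exists_dslope_of_zero (hγ : IsPositiveBoundary Ω γ) (hΩ : IsConnected Ω)
    (hΩb : Bornology.IsBounded Ω) {φ : ℂ → ℂ}
    (hφ : AnalyticOnNhd ℂ φ (closure Ω)) (hne : ∀ z ∈ frontier Ω, φ z ≠ 0) {a : ℂ} (ha : a ∈ Ω)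
    (h0 : φ a = 0) : ∃ ψ : ℂ → ℂ, AnalyticOnNhd ℂ ψ (closure Ω) ∧ (∀ z ∈ frontier Ω, ψ z ≠ 0) ∧
      (φ = fun z => (z - a) * ψ z) ∧ zeroCount φ Ω = zeroCount ψ Ω + 1 := by
  have hmul : φ = fun z => (z - a) * dslope φ a z := by
    ext z
    exact (sub_smul_dslope_of_zero h0 z).symm
  have hψ := hφ.dslope (subset_closure ha)
  have hψne : ∀ z ∈ frontier Ω, dslope φ a z ≠ 0 := by
    intro z hz h
    have := hne z hz
    rw [hmul] at this
    exact this (by simp only [h, mul_zero])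
  refine ⟨dslope φ a, hψ, hψne, hmul, ?_⟩
  conv_lhs => rw [hmul]
  exact zeroCount_sub_mul ha (hψ.mono subset_closure) (hγ.finite_zeros hΩ hΩb hψ hψne)
    fun z hz => hγ.analyticOrderAt_ne_top hΩ hψ hψne z (subset_closure hz)

lemma one_le_zeroCount (hγ : IsPositiveBoundary Ω γ) (hΩ : IsConnected Ω)
    (hΩb : Bornology.IsBounded Ω) {φ : ℂ → ℂ}
    (hφ : AnalyticOnNhd ℂ φ (closure Ω)) (hne : ∀ z ∈ frontier Ω, φ z ≠ 0)
    (h : ∃ a ∈ Ω, φ a = 0) : 1 ≤ zeroCount φ Ω := by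
  obtain ⟨a, ha, h0⟩ := h
  obtain ⟨ψ, -, -, -, h⟩ := hγ.exists_dslope_of_zero hΩ hΩb hφ hne ha h0
  omega

/-- The **argument principle** for the positive boundary of a bounded domain. -/
theorem argument_principle (hγ : IsPositiveBoundary Ω γ) (hΩ : IsConnected Ω)
    (hΩo : IsOpen Ω) (hΩb : Bornology.IsBounded Ω) {φ : ℂ → ℂ}
    (hφ : AnalyticOnNhd ℂ φ (closure Ω)) (hne : ∀ z ∈ frontier Ω, φ z ≠ 0) :
    contourIntegral (fun z => deriv φ z / φ z) γ = 2 * Real.pi * Complex.I * zeroCount φ Ω := by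
  -- Without zeros φ'/φ is analytic and Cauchy's theorem gives 0. Each factor z - a adds the winding
  -- integral 2πi.
  induction hn : zeroCount φ Ω generalizing φ with
  | zero =>
    have hne' : ∀ z ∈ closure Ω, φ z ≠ 0 := by
      intro z hz h0
      by_cases hzΩ : z ∈ Ω
      · have := hγ.one_le_zeroCount hΩ hΩb hφ hne ⟨z, hzΩ, h0⟩
        omega
      · exact hne z ⟨hz, by rwa [hΩo.interior_eq]⟩ h0
    rw [hγ.contourIntegral_eq_zero hΩ hΩo hΩb fun z hz =>
      (hφ z hz).deriv.fun_div (hφ z hz) (hne' z hz)]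
    simp
  | succ n ih =>
    obtain ⟨a, ha, h0⟩ : ∃ a ∈ Ω, φ a = 0 := by
      by_contra! h
      rw [zeroCount_eq_zero h] at hn
      omega
    obtain ⟨ψ, hψ, hψne, hmul, hcount⟩ := hγ.exists_dslope_of_zero hΩ hΩb hφ hne ha h0
    have hih := ih hψ hψne (by omega)
    have haγ : a ∉ γ '' Icc 0 1 := by
      rw [hγ.image_eq]
      exact fun h => h.2 (by rwa [hΩo.interior_eq])
    have hfc : ContinuousOn (fun z => deriv ψ z / ψ z) (γ '' Icc 0 1) := by
      rw [hγ.image_eq]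
      exact fun z hz => ((hψ z (frontier_subset_closure hz)).deriv.fun_div
        (hψ z (frontier_subset_closure hz)) (hψne z hz)).continuousAt.continuousWithinAt
    have hlog : EqOn (fun z => deriv φ z / φ z) (fun z => (z - a)⁻¹ + deriv ψ z / ψ z)
        (γ '' Icc 0 1) := by
      intro z hz
      have hza : z - a ≠ 0 := sub_ne_zero.2 (ne_of_mem_of_not_mem hz haγ)
      rw [hγ.image_eq] at hz
      have h := logDeriv_mul (f := fun z => z - a) z hza (hψne z hz) (by fun_prop)
        (hψ z (frontier_subset_closure hz)).differentiableAt
      rw [← hmul, logDeriv_apply, logDeriv_apply, logDeriv_apply] at h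
      simpa using h
    rw [contourIntegral_congr hlog, hγ.isRectifiableLoop.contourIntegral_add
      (continuousOn_sub_inv haγ) hfc, hih]
    have hw := hγ.windingIntegral_of_mem hΩ.isPreconnected hΩo hΩb ha
    rw [windingIntegral] at hw
    rw [hw]
    push_cast
    ring

end IsPositiveBoundary

/-! ### Continuous phases -/

section Phase

variable {X : Type*} [TopologicalSpace X]

/-- A continuous function whose exponential is constant is constant. -/
lemma eq_of_exp_eq [PreconnectedSpace X] {g : X → ℂ} (hg : Continuous g)
    (h : ∀ x y, Complex.exp (g x) = Complex.exp (g y)) (x y : X) : g x = g y := by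
  have hloc : IsLocallyConstant g := by
    refine (IsLocallyConstant.iff_eventually_eq g).2 fun x => ?_
    -- Values with equal exponentials differ by a multiple of 2πi, so values less than 2π apart
    -- coincide.
    filter_upwards [hg.continuousAt.eventually (Metric.ball_mem_nhds (g x) Real.two_pi_pos)]
      with y hy
    obtain ⟨n, hn⟩ := Complex.exp_eq_exp_iff_exists_int.1 (h y x)
    rw [dist_eq_norm, hn, add_sub_cancel_left] at hy
    have hnorm : ‖(n : ℂ) * (2 * Real.pi * Complex.I)‖ = |(n : ℝ)| * (2 * Real.pi) := by
      simp [abs_of_pos Real.pi_pos]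
    rw [hnorm] at hy
    have hlt : |(n : ℝ)| < 1 := by
      have := Real.two_pi_pos
      by_contra! hle
      nlinarith
    have hn0 : n = 0 := Int.abs_lt_one_iff.1 (by exact_mod_cast hlt)
    rw [hn, hn0, Int.cast_zero, zero_mul, add_zero]
  exact hloc.apply_eq_of_preconnectedSpace x y

/-- The phase of a nowhere vanishing function is unique up to an additive constant. -/
lemma IsPhase.exists_eq_add [PreconnectedSpace X] [Nonempty X] {f : X → ℂ} {θ θ' : X → ℝ}
    (hθ : IsPhase f θ) (hθ' : IsPhase f θ') (hf : ∀ x, f x ≠ 0) :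
    ∃ k : ℝ, ∀ x, θ x = θ' x + k := by
  have hexp : ∀ x, Complex.exp ((θ x : ℂ) * Complex.I - (θ' x : ℂ) * Complex.I) = 1 := by
    intro x
    have h0 : (‖f x‖ : ℂ) ≠ 0 := by simpa using hf x
    have h : Complex.exp ((θ x : ℂ) * Complex.I) = Complex.exp ((θ' x : ℂ) * Complex.I) :=
      mul_left_cancel₀ h0 ((hθ.2 x).symm.trans (hθ'.2 x))
    rw [Complex.exp_sub, h, div_self (Complex.exp_ne_zero _)]
  have hcont : Continuous fun x => (θ x : ℂ) * Complex.I - (θ' x : ℂ) * Complex.I :=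
    ((Complex.continuous_ofReal.comp hθ.1).mul continuous_const).sub
      ((Complex.continuous_ofReal.comp hθ'.1).mul continuous_const)
  obtain ⟨x₀⟩ := ‹Nonempty X›
  refine ⟨θ x₀ - θ' x₀, fun x => ?_⟩
  have h := eq_of_exp_eq hcont (fun x y => (hexp x).trans (hexp y).symm) x x₀
  rw [← sub_mul, ← sub_mul] at h
  have h' : (θ x : ℂ) - θ' x = θ x₀ - θ' x₀ := mul_right_cancel₀ Complex.I_ne_zero h
  have h'' : θ x - θ' x = θ x₀ - θ' x₀ := by exact_mod_cast h'
  linarith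

end Phase

/-- A nowhere vanishing continuous function on the real line has a continuous phase. -/
lemma exists_isPhase {f : ℝ → ℂ} (hf : Continuous f) (h0 : ∀ s, f s ≠ 0) :
    ∃ θ : ℝ → ℝ, IsPhase f θ := by
  -- Lifting along the covering exp gives a continuous logarithm, whose imaginary part is a phase.
  obtain ⟨L, ⟨-, hL⟩, -⟩ := Complex.isCoveringMapOn_exp.existsUnique_continuousMap_lifts
    ⟨f, hf⟩ (a₀ := (0 : ℝ)) (e₀ := Complex.log (f 0)) (Complex.exp_log (h0 0)) h0
  have hexp : ∀ s, Complex.exp (L s) = f s := fun s => congrFun hL s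
  refine ⟨fun s => (L s).im, Complex.continuous_im.comp L.continuous, fun s => ?_⟩
  rw [← hexp, Complex.norm_exp, Complex.ofReal_exp, ← Complex.exp_add, Complex.re_add_im]

/-- A continuous logarithm of a differentiable function is differentiable. -/
lemma hasDerivAt_of_exp_eq {L f : ℝ → ℂ} (hL : Continuous L) (h : ∀ s, Complex.exp (L s) = f s)
    {t : ℝ} {f' : ℂ} (hf : HasDerivAt f f' t) : HasDerivAt L (f' / f t) t := by
  have h0 : f t ≠ 0 := h t ▸ Complex.exp_ne_zero _
  -- Near `t`, `L` is the principal logarithm of f(s)/f(t) plus `L t`, as its imaginary part moves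
  -- by less than π.
  have hd : HasDerivAt (fun s => Complex.log (f s / f t) + L t) (f' / f t) t := by
    have h1 : f t / f t = 1 := div_self h0
    have := ((hf.div_const (f t)).clog_real (by
      rw [h1]; exact Complex.one_mem_slitPlane)).add_const (L t)
    rwa [h1, div_one] at this
  refine hd.congr_of_eventuallyEq ?_
  filter_upwards [hL.continuousAt.eventually (Metric.ball_mem_nhds (L t) Real.pi_pos)] with s hs
  have him : |(L s - L t).im| < Real.pi :=
    (Complex.abs_im_le_norm _).trans_lt (mem_ball_iff_norm.1 hs)
  rw [← h s, ← h t, ← Complex.exp_sub, Complex.log_exp (abs_lt.1 him).1 (abs_lt.1 him).2.le,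
    sub_add_cancel]

/-- The change of phase along a closed curve is the integral of the logarithmic derivative. -/
lemma IsRectifiableLoop.contourIntegral_deriv_div {γ : ℝ → ℂ} (hγ : IsRectifiableLoop γ)
    {φ : ℂ → ℂ} (hφ : ∀ z ∈ γ '' Icc 0 1, AnalyticAt ℂ φ z)
    (hcont : Continuous fun s => φ (γ s)) (h0 : ∀ s, φ (γ s) ≠ 0) {θ : ℝ → ℝ}
    (hθ : IsPhase (fun s => φ (γ s)) θ) :
    contourIntegral (fun z => deriv φ z / φ z) γ = ((θ 1 - θ 0 : ℝ) : ℂ) * Complex.I := by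
  set L : ℝ → ℂ := fun s => (Real.log ‖φ (γ s)‖ : ℂ) + (θ s : ℂ) * Complex.I with hL
  have hLc : Continuous L := by
    refine (Complex.continuous_ofReal.comp (hcont.norm.log fun s => ?_)).add
      ((Complex.continuous_ofReal.comp hθ.1).mul continuous_const)
    exact norm_ne_zero_iff.2 (h0 s)
  have hexp : ∀ s, Complex.exp (L s) = φ (γ s) := by
    intro s
    rw [Complex.exp_add, ← Complex.ofReal_exp, Real.exp_log (norm_pos_iff.2 (h0 s))]
    exact (hθ.2 s).symm
  obtain ⟨T, hT, hd⟩ := hγ.exists_hasDerivAt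
  have hint : IntervalIntegrable (fun t => deriv φ (γ t) / φ (γ t) * deriv γ t)
      MeasureTheory.volume 0 1 := by
    refine hγ.integrable_comp_mul (f := fun z => deriv φ z / φ z) fun z hz => ?_
    have hz' := hz
    obtain ⟨s, -, rfl⟩ := hz'
    exact ((hφ _ hz).deriv.fun_div (hφ _ hz) (h0 s)).continuousAt.continuousWithinAt
  rw [contourIntegral, MeasureTheory.integral_eq_of_hasDerivAt_off_countable_of_le L _ zero_le_one
    hT hLc.continuousOn (fun t ht => ?_) hint]
  -- The curve is closed, so the log-modulus cancels and only the phase increment remains.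
  · simp only [hL, ← hγ.closed]
    push_cast
    ring
  · have hφt := (hφ _ (mem_image_of_mem γ (Ioo_subset_Icc_self ht.1))).differentiableAt.hasDerivAt
    have h := hasDerivAt_of_exp_eq hLc hexp (hφt.comp t (hd t ht).hasDerivAt)
    rw [← div_mul_eq_mul_div] at h
    exact h

/-- The increment of a phase of a periodic function over a period does not depend on its start. -/
lemma IsPhase.add_one_sub_eq {f : ℝ → ℂ} (hf : Function.Periodic f 1) (h0 : ∀ s, f s ≠ 0)
    {θ : ℝ → ℝ} (hθ : IsPhase f θ) (s : ℝ) : θ (s + 1) - θ s = θ 1 - θ 0 := by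
  have hθ' : IsPhase f fun s => θ (s + 1) := by
    refine ⟨hθ.1.comp (by fun_prop), fun s => ?_⟩
    have h := hθ.2 (s + 1)
    rwa [hf s] at h
  obtain ⟨k, hk⟩ := hθ'.exists_eq_add hθ h0
  have h1 := hk s
  have h2 := hk 0
  simp only [zero_add] at h2
  linarith

/-! ### Spin-momentum locking -/

/-- Points of constant phase of a wave on a closed curve, around which the phase turns at a nonzero
rate, travel with the corresponding mean velocity. -/
lemma phasePointsTravel_spinWave {φ : ℂ → ℂ} {γ : ℝ → ℂ} (h0 : ∀ s, φ (γ s) ≠ 0)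
    {θ : ℝ → ℝ} (hθ : IsPhase (fun s => φ (γ s)) θ) {K : ℝ} (hK : 0 < K)
    (hθK : ∀ s, θ (s + 1) - θ s = K) (ω : ℝ) :
    PhasePointsTravel (spinWave φ ω) γ (-(ω / K)) := by
  have hphase : IsPhase (fun p : ℝ × ℝ => spinWave φ ω (γ p.1) p.2)
      fun p => θ p.1 + ω * p.2 := by
    refine ⟨by have := hθ.1; fun_prop, fun p => ?_⟩
    have he : Complex.exp (Complex.I * ω * p.2) =
        Complex.exp (((ω * p.2 : ℝ) : ℂ) * Complex.I) := by
      push_cast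
      ring_nf
    have h := hθ.2 p.1
    simp only at h
    simp only [spinWave]
    rw [norm_mul, he, Complex.norm_exp_ofReal_mul_I, mul_one]
    conv_lhs => rw [h]
    rw [mul_assoc, ← Complex.exp_add]
    push_cast
    ring_nf
  have hne : ∀ p : ℝ × ℝ, spinWave φ ω (γ p.1) p.2 ≠ 0 := fun p =>
    mul_ne_zero (h0 p.1) (Complex.exp_ne_zero _)
  -- The deviation of θ from linear growth is periodic, hence bounded. This gives both surjectivity
  -- of θ and the mean velocity.
  have hper : Function.Periodic (fun s => θ s - K * s) 1 := by
    intro s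
    have := hθK s
    simp only
    linarith
  obtain ⟨C, hC⟩ : ∃ C, ∀ s, |θ s - K * s| ≤ C := by
    obtain ⟨C, hC⟩ := isCompact_Icc.exists_bound_of_continuousOn (s := Icc (0 : ℝ) 1)
      (f := fun s => θ s - K * s) (by have := hθ.1; fun_prop)
    refine ⟨C, fun s => ?_⟩
    obtain ⟨y, hy, hys⟩ := hper.exists_mem_Ico₀ one_pos s
    rw [hys]
    exact hC y (Ico_subset_Icc_self hy)
  have hsurj : Function.Surjective θ := by
    refine hθ.1.surjective ?_ ?_
    · refine tendsto_atTop_mono (f := fun s => K * s + -C) (fun s => ?_)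
        (tendsto_atTop_add_const_right _ _ (tendsto_id.const_mul_atTop hK))
      linarith [(abs_le.1 (hC s)).1]
    · refine tendsto_atBot_mono (f := fun s => K * s + C) (fun s => ?_)
        (tendsto_atBot_add_const_right _ _ (tendsto_id.const_mul_atBot hK))
      linarith [(abs_le.1 (hC s)).2]
  refine ⟨⟨_, hphase⟩, fun Θ hΘ c => ?_⟩
  obtain ⟨k, hk⟩ := hΘ.exists_eq_add hphase hne
  refine ⟨fun t => ?_, fun s hs => ?_⟩
  · obtain ⟨s, hs⟩ := hsurj (c - k - ω * t)
    exact ⟨s, by rw [hk, hs]; ring⟩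
  · rw [tendsto_iff_norm_sub_tendsto_zero]
    have hlim : Tendsto (fun t : ℝ => (|c - k| + C) / K / t) atTop (𝓝 0) :=
      tendsto_const_nhds.div_atTop tendsto_id
    refine squeeze_zero' (Eventually.of_forall fun t => norm_nonneg _) ?_ hlim
    filter_upwards [eventually_gt_atTop 0] with t ht
    have hst : θ (s t) + ω * t + k = c := by rw [← hs t, hk]
    -- Solving the constant phase equation for `s t` leaves a bounded numerator over `t`.
    have heq : s t / t - -(ω / K) = ((c - k) - (θ (s t) - K * s t)) / K / t := by
      rw [← hst]
      field_simp
      ring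
    rw [heq, norm_div, norm_div, Real.norm_of_nonneg ht.le, Real.norm_of_nonneg hK.le,
      Real.norm_eq_abs]
    gcongr
    exact (abs_sub _ _).trans (by gcongr; exact hC _)

theorem mainTheorem1 (Ω : Set ℂ) (hΩ_open : IsOpen Ω) (hΩ_bdd : Bornology.IsBounded Ω)
    (hΩ_sc : IsSimplyConnected Ω) (γ : ℝ → ℂ) (hγ : IsPositiveBoundary Ω γ)
    (φ : ℂ → ℂ) (hφ : AnalyticOnNhd ℂ φ (closure Ω))
    (hloc : ∃ z₁ ∈ Ω, 0 < ‖φ z₁‖ ∧ ∀ z ∈ frontier Ω, ‖φ z₁‖ < ‖φ z‖) :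
    -- `φ` has a zero in the bulk and none on the edge
    (∃ z₀ ∈ Ω, φ z₀ = 0) ∧ (∀ z ∈ frontier Ω, φ z ≠ 0) ∧
    -- the winding number is the number of zeros, which is finite and at least one
    {z ∈ Ω | φ z = 0}.Finite ∧
    1 / (2 * (Real.pi : ℂ) * Complex.I) * contourIntegral (fun z => deriv φ z / φ z) γ =
      (zeroCount φ Ω : ℂ) ∧
    1 ≤ zeroCount φ Ω ∧
    -- the phase of `φ` makes that many counterclockwise turns in one turn around the boundary
    (∃ θ : ℝ → ℝ, IsPhase (fun s => φ (γ s)) θ) ∧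
    (∀ θ : ℝ → ℝ, IsPhase (fun s => φ (γ s)) θ →
      ∀ s, θ (s + 1) - θ s = 2 * Real.pi * (zeroCount φ Ω : ℝ)) ∧
    -- spin-momentum locking: phase points of spin-up waves go clockwise, of spin-down waves
    -- counterclockwise
    (∀ ω : ℝ, 0 < ω →
      PhasePointsTravel (spinWave φ ω) γ (-(ω / (2 * Real.pi * (zeroCount φ Ω : ℝ)))) ∧
      PhasePointsTravel (spinWave φ (-ω)) γ (ω / (2 * Real.pi * (zeroCount φ Ω : ℝ)))) := by
  obtain ⟨z₁, hz₁, hpos, hlt⟩ := hloc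
  have hΩ : IsConnected Ω := hΩ_sc.isPathConnected.isConnected
  have hloop := hγ.isRectifiableLoop
  have hne : ∀ z ∈ frontier Ω, φ z ≠ 0 := fun z hz => norm_pos_iff.1 (hpos.trans (hlt z hz))
  have hzero := exists_zero_of_norm_lt_frontier hΩ_bdd hΩ_open hφ hz₁ hlt
  have hN := hγ.one_le_zeroCount hΩ hΩ_bdd hφ hne hzero
  have harg := hγ.argument_principle hΩ hΩ_open hΩ_bdd hφ hne
  have hγmem : ∀ s, γ s ∈ frontier Ω := by
    intro s
    obtain ⟨y, hy, hys⟩ := hγ.periodic.exists_mem_Ico₀ one_pos s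
    rw [hys, ← hγ.image_eq]
    exact mem_image_of_mem γ (Ico_subset_Icc_self hy)
  have h0 : ∀ s, φ (γ s) ≠ 0 := fun s => hne _ (hγmem s)
  have han : ∀ s, AnalyticAt ℂ φ (γ s) := fun s => hφ _ (frontier_subset_closure (hγmem s))
  have hcont : Continuous fun s => φ (γ s) := continuous_iff_continuousAt.2 fun s =>
    (han s).continuousAt.comp hγ.continuous.continuousAt
  have hincr : ∀ θ : ℝ → ℝ, IsPhase (fun s => φ (γ s)) θ →
      ∀ s, θ (s + 1) - θ s = 2 * Real.pi * (zeroCount φ Ω : ℝ) := by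
    intro θ hθ s
    have h := hloop.contourIntegral_deriv_div (by rintro _ ⟨t, -, rfl⟩; exact han t) hcont h0 hθ
    rw [harg, mul_right_comm] at h
    rw [hθ.add_one_sub_eq (fun s => by simp only [hγ.periodic s]) h0]
    exact_mod_cast (mul_right_cancel₀ Complex.I_ne_zero h).symm
  obtain ⟨θ, hθ⟩ := exists_isPhase hcont h0
  refine ⟨hzero, hne, hγ.finite_zeros hΩ hΩ_bdd hφ hne, ?_, hN, ⟨θ, hθ⟩, hincr, fun ω _ => ?_⟩
  · have : (Real.pi : ℂ) ≠ 0 := Complex.ofReal_ne_zero.2 Real.pi_ne_zero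
    rw [harg]
    field_simp
  · have hK : 0 < 2 * Real.pi * (zeroCount φ Ω : ℝ) :=
      mul_pos Real.two_pi_pos (by exact_mod_cast hN)
    refine ⟨phasePointsTravel_spinWave h0 hθ hK (hincr θ hθ) ω, ?_⟩
    have h := phasePointsTravel_spinWave h0 hθ hK (hincr θ hθ) (-ω)
    rwa [neg_div, neg_neg] at h
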